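/- Let $1 \le r < 2$, let $G$ be a connected finite-dimensional real Lie group with Lie algebra $\mathfrak g = T_1 G$, and let $\|\cdot\|_{\mathfrak g}$ be a norm on $\mathfrak g$. Give each tangent space the left-invariant norm $\|x\|_{T_gG} = \|g^{-1}x\|_{\mathfrak g}$, where $g^{-1}x \in \mathfrak g$ is the image of $x \in T_gG$ under the derivative of left multiplication by $g^{-1}$, and let $d(g,g')$ be the infimum of the lengths $\int \|\gamma'(t)\|_{T_{\gamma(t)}G}\,dt$ over all continuously differentiable paths $\gamma$ in $G$ from $g$ to $g'$. For a smooth curve $\gamma:[a,b]\to G$ define its left trace $\gamma_l:[a,b]\to\mathfrak g$ by $\gamma_l(t)=\int_a^t \gamma(s)^{-1}\gamma'(s)\,ds$, and put $$\|\gamma\|_{V^r}=\sup_{a=t_0<t_1<\dots<t_n=b}\Big(\sum_{j=0}^{n-1} d(\gamma(t_{j+1}),\gamma(t_j))^r\Big)^{1/r},\qquad \|\gamma_l\|_{V^r}=\sup_{a=t_0<t_1<\dots<t_n=b}\Big(\sum_{j=0}^{n-1}\|\gamma_l(t_{j+1})-\gamma_l(t_j)\|_{\mathfrak g}^r\Big)^{1/r}.$$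 Then there is a constant $C>0$, depending only on $r$, $G$ and $\|\cdot\|_{\mathfrak g}$, such that for all $a \le b$ and all smooth curves $\gamma:[a,b]\to G$ both quantities are finite and $$\|\gamma\|_{V^r}\le\|\gamma_l\|_{V^r}+C\min\big(\|\gamma_l\|_{V^r}^2,\|\gamma_l\|_{V^r}^r\big)$$ and $$\|\gamma_l\|_{V^r}\le\|\gamma\|_{V^r}+C\min\big(\|\gamma\|_{V^r}^2,\|\gamma\|_{V^r}^r\big).$$ -/

import Mathlib

open scoped Manifold ContDiff ENNReal

noncomputable section

namespace LieVariation

section Variation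

variable {X : Type*}

/-- The `r`-variation over `[a, b]` of a curve `γ` in a space with (extended) distance function
`d`: the supremum of `(∑ d(γ(t_{j+1}), γ(t_j))^r)^{1/r}` over all partitions
`a = t 0 < t 1 < ... < t n = b`. Only the values of `γ` on `[a, b]` matter. -/
def rVariation (d : X → X → ℝ≥0∞) (r a b : ℝ) (γ : ℝ → X) : ℝ≥0∞ :=
  ⨆ (n : ℕ) (t : ℕ → ℝ) (_ : StrictMonoOn t (Set.Iic n)) (_ : t 0 = a) (_ : t n = b),
    (∑ j ∈ Finset.range n, d (γ (t (j + 1))) (γ (t j)) ^ r) ^ (1 / r)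

end Variation

section LieGroup

variable {E : Type*} [NormedAddCommGroup E] [NormedSpace ℝ E]
  {H : Type*} [TopologicalSpace H] (I : ModelWithCorners ℝ E H)
  {G : Type*} [TopologicalSpace G] [ChartedSpace H G] [Group G]

/-- The map `x ↦ g⁻¹ x` from `T_g G` to the Lie algebra `T_1 G`: the derivative at `g` of left
multiplication by `g⁻¹`. (Its values lie in the tangent space at `g⁻¹ * g`, which is
the tangent space at `1`.) -/
def toLieAlgebra (g : G) (x : TangentSpace I g) : GroupLieAlgebra I G :=
  mfderiv I I (fun h : G ↦ g⁻¹ * h) g x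

/-- The left-invariant norm `‖x‖_{T_g G} = ‖g⁻¹ x‖` on the tangent space at `g` defined by a norm
`N` on the Lie algebra. -/
@[reducible]
def leftInvariantENorm (N : Seminorm ℝ (GroupLieAlgebra I G)) (g : G) : ENorm (TangentSpace I g) :=
  ⟨fun x ↦ ENNReal.ofReal (N (toLieAlgebra I g x))⟩

/-- The left-invariant distance on `G`: the infimum of the lengths
`∫ ‖γ'(t)‖_{T_{γ(t)} G} dt` of the continuously differentiable paths from `g` to `h`. -/
def leftInvariantEDist (N : Seminorm ℝ (GroupLieAlgebra I G)) (g h : G) : ℝ≥0∞ :=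
  letI : ∀ x : G, ENorm (TangentSpace I x) := leftInvariantENorm I N
  Manifold.riemannianEDist I g h

/-- The distance on the Lie algebra defined by a norm `N`. -/
def lieAlgebraEDist (N : Seminorm ℝ (GroupLieAlgebra I G)) (u v : GroupLieAlgebra I G) : ℝ≥0∞ :=
  ENNReal.ofReal (N (u - v))

/-- The velocity `γ(s)⁻¹ γ'(s)` of a curve `γ : [a, b] → G`, pulled back to the Lie algebra. -/
def leftVelocity (a b : ℝ) (γ : ℝ → G) (s : ℝ) : GroupLieAlgebra I G :=
  toLieAlgebra I (γ s) (mfderivWithin 𝓘(ℝ, ℝ) I γ (Set.Icc a b) s (1 : ℝ))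

/-- The left trace `γ_l(t) = ∫_a^t γ(s)⁻¹ γ'(s) ds` of a curve `γ : [a, b] → G`. The integral is
taken in the model space `E`, of which the tangent space at `1` is a synonym (with the same
vector space structure and topology). -/
def leftTrace (a b : ℝ) (γ : ℝ → G) (t : ℝ) : GroupLieAlgebra I G :=
  (∫ s in a..t, (leftVelocity I a b γ s : E) : E)

/-- The `r`-variation `‖γ‖_{V^r}` of a curve `γ : [a, b] → G` in the left-invariant distance. -/
def groupVariation (N : Seminorm ℝ (GroupLieAlgebra I G)) (r a b : ℝ) (γ : ℝ → G) : ℝ≥0∞ :=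
  rVariation (leftInvariantEDist I N) r a b γ

/-- The `r`-variation `‖γ_l‖_{V^r}` of the left trace of a curve `γ : [a, b] → G`, in the distance
of the norm `N` on the Lie algebra. -/
def traceVariation (N : Seminorm ℝ (GroupLieAlgebra I G)) (r a b : ℝ) (γ : ℝ → G) : ℝ≥0∞ :=
  rVariation (lieAlgebraEDist I N) r a b (leftTrace I a b γ)

end LieGroup

end LieVariation

end

/-!
In a chart at the identity, the product of `G` is the sum up to a second order error and the left
velocity of a curve is its coordinate velocity up to a first order error. Hence
`log (γ s⁻¹ * γ t)` is additive in the interval `[s, t]` up to a quadratic error, and its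
derivative at `t = s` is that of the left trace `γ_l`. The `r`-th power of the `r`-variation of
either curve is a superadditive function `Ω` of the interval, and the error of splitting an
interval is of order `Ω ^ (2 / r)` with `2 / r > 1`, so bisecting the interval along `Ω` sums the
errors to `‖log (γ s⁻¹ * γ t) - (γ_l t - γ_l s)‖ ≤ K * Ω s t ^ (2 / r)` on intervals of small
variation.

Since `d (γ t) (γ s)` and the norm of `log (γ s⁻¹ * γ t)` agree to second order, Minkowski's
inequality in `ℓ^r` gives the two bounds with the square of the variation when the variation is
small. Otherwise the interval is cut into pieces of small variation, whose number is at most of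
the order of the `r`-th power of the variation.
-/

open Set Filter Topology MeasureTheory

noncomputable section

namespace LieVariation

section Variation

lemma sum_rpow_le_rpow_sum {ι : Type*} (s : Finset ι) (f : ι → ℝ≥0∞) {p : ℝ} (hp : 1 ≤ p) :
    ∑ i ∈ s, f i ^ p ≤ (∑ i ∈ s, f i) ^ p := by
  classical
  induction s using Finset.induction_on with
  | empty => simp
  | insert i s hi ih =>
    rw [Finset.sum_insert hi, Finset.sum_insert hi]
    exact (add_le_add_right ih _).trans (ENNReal.add_rpow_le_rpow_add _ _ hp)

variable {X : Type*} {d : X → X → ℝ≥0∞} {r a b s t : ℝ} {c : ℝ → X}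

/-- The `r`-th power of the `r`-variation over `[a, b]`. Unlike in `rVariation`, the partition
points may repeat and need not include `a` and `b`, as in `eVariationOn`. -/
def powVariation (d : X → X → ℝ≥0∞) (r a b : ℝ) (c : ℝ → X) : ℝ≥0∞ :=
  ⨆ p : ℕ × {u : ℕ → ℝ // Monotone u ∧ ∀ i, u i ∈ Icc a b},
    ∑ i ∈ Finset.range p.1, d (c (p.2.1 (i + 1))) (c (p.2.1 i)) ^ r

lemma sum_le_powVariation (n : ℕ) {u : ℕ → ℝ} (hu : Monotone u) (hmem : ∀ i, u i ∈ Icc a b) :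
    ∑ i ∈ Finset.range n, d (c (u (i + 1))) (c (u i)) ^ r ≤ powVariation d r a b c :=
  le_iSup (fun p : ℕ × {u : ℕ → ℝ // Monotone u ∧ ∀ i, u i ∈ Icc a b} ↦
    ∑ i ∈ Finset.range p.1, d (c (p.2.1 (i + 1))) (c (p.2.1 i)) ^ r) (n, ⟨u, hu, hmem⟩)

lemma powVariation_le_iff {B : ℝ≥0∞} :
    powVariation d r a b c ≤ B ↔ ∀ (n : ℕ) (u : ℕ → ℝ), Monotone u → (∀ i, u i ∈ Icc a b) →
      ∑ i ∈ Finset.range n, d (c (u (i + 1))) (c (u i)) ^ r ≤ B := by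
  simp only [powVariation, iSup_le_iff, Prod.forall, Subtype.forall, and_imp]

lemma exists_strictMonoOn_sum_eq {f : ℝ → ℝ → ℝ≥0∞} (hf : ∀ x, f x x = 0) {u : ℕ → ℝ}
    (hu : Monotone u) (n : ℕ) :
    ∃ (m : ℕ) (t : ℕ → ℝ), StrictMonoOn t (Iic m) ∧ t 0 = u 0 ∧ t m = u n ∧
      ∑ i ∈ Finset.range n, f (u (i + 1)) (u i) = ∑ i ∈ Finset.range m, f (t (i + 1)) (t i) := by
  induction n with
  | zero => exact ⟨0, u, by simp [StrictMonoOn], rfl, rfl, by simp⟩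
  | succ n ih =>
    obtain ⟨m, t, ht, h0, hm, hsum⟩ := ih
    rcases (hu n.le_succ).eq_or_lt with hrepeat | hnew
    · refine ⟨m, t, ht, h0, hm.trans hrepeat, ?_⟩
      rw [Finset.sum_range_succ, hsum, ← Nat.succ_eq_add_one, ← hrepeat, hf, add_zero]
    · refine ⟨m + 1, fun i ↦ if i ≤ m then t i else u (n + 1), ?_, by simpa using h0, by simp, ?_⟩
      · intro i hi j hj hij
        simp only [mem_Iic] at hi hj
        have him : i ≤ m := by omega
        simp only [him, if_true]
        split_ifs with hjm
        · exact ht him hjm hij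
        · exact (ht.monotoneOn him (by simp) him).trans_lt (hm ▸ hnew)
      · rw [Finset.sum_range_succ, Finset.sum_range_succ, hsum]
        congr 1
        · refine Finset.sum_congr rfl fun i hi ↦ ?_
          have him : i < m := Finset.mem_range.1 hi
          simp [him.le, Nat.succ_le_of_lt him]
        · simp [hm]

lemma rVariation_rpow_le (hr : 0 < r) : rVariation d r a b c ^ r ≤ powVariation d r a b c := by
  rw [← ENNReal.le_rpow_inv_iff hr, rVariation]
  refine iSup_le fun n ↦ iSup_le fun t ↦ iSup_le fun ht ↦ iSup_le fun h0 ↦ iSup_le fun hn ↦ ?_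
  rw [one_div]
  gcongr
  have hmono : Monotone fun i ↦ t (min i n) := fun i j hij ↦
    ht.monotoneOn (by simp) (by simp) (by omega)
  refine le_trans (le_of_eq ?_) (sum_le_powVariation n hmono fun i ↦ ⟨?_, ?_⟩)
  · refine Finset.sum_congr rfl fun i hi ↦ ?_
    have hin : i < n := Finset.mem_range.1 hi
    simp [hin.le, Nat.succ_le_of_lt hin]
  · rw [← h0]; exact ht.monotoneOn (by simp) (by simp) (by omega)
  · rw [← hn]; exact ht.monotoneOn (by simp) (by simp) (by omega)

lemma powVariation_le_rVariation_rpow (hd : ∀ x, d x x = 0) (hr : 0 < r) (hab : a ≤ b) :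
    powVariation d r a b c ≤ rVariation d r a b c ^ r := by
  refine powVariation_le_iff.2 fun n u hu hmem ↦ ?_
  let w : ℕ → ℝ := fun i ↦ if i = 0 then a else if i ≤ n + 1 then u (i - 1) else b
  have hw : Monotone w := by
    refine monotone_nat_of_le_succ fun i ↦ ?_
    have ha := fun i ↦ (hmem i).1
    have hb := fun i ↦ (hmem i).2
    have hpred : u (i - 1) ≤ u i := hu (by omega)
    simp only [w]
    split_ifs <;> first | contradiction | omega | simp [ha, hb, hpred]
  obtain ⟨m, t, ht, h0, hm, hsum⟩ := exists_strictMonoOn_sum_eq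
    (f := fun x y ↦ d (c x) (c y) ^ r) (fun x ↦ by simp [hd, hr]) hw (n + 2)
  have hle : ∑ i ∈ Finset.range n, d (c (u (i + 1))) (c (u i)) ^ r ≤
      ∑ i ∈ Finset.range m, d (c (t (i + 1))) (c (t i)) ^ r := by
    rw [← hsum, Finset.sum_range_succ, Finset.sum_range_succ']
    refine le_trans (Finset.sum_le_sum fun i hi ↦ ?_) (le_self_add.trans le_self_add)
    have hin : i < n := Finset.mem_range.1 hi
    simp [w, hin.le, Nat.succ_le_of_lt hin]
  refine hle.trans ?_
  rw [← ENNReal.rpow_inv_le_iff hr, ← one_div, rVariation]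
  refine le_iSup_of_le m (le_iSup_of_le t ?_)
  rw [iSup_pos ht, iSup_pos (h0.trans (by simp [w])), iSup_pos (hm.trans (by simp [w]))]

lemma rVariation_rpow (hd : ∀ x, d x x = 0) (hr : 0 < r) (hab : a ≤ b) :
    rVariation d r a b c ^ r = powVariation d r a b c :=
  (rVariation_rpow_le hr).antisymm (powVariation_le_rVariation_rpow hd hr hab)

lemma rVariation_le_iff (hd : ∀ x, d x x = 0) (hr : 0 < r) (hab : a ≤ b) {B : ℝ≥0∞} :
    rVariation d r a b c ≤ B ↔ ∀ (n : ℕ) (u : ℕ → ℝ), Monotone u → (∀ i, u i ∈ Icc a b) →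
      (∑ i ∈ Finset.range n, d (c (u (i + 1))) (c (u i)) ^ r) ^ (1 / r) ≤ B := by
  simp only [one_div, ENNReal.rpow_inv_le_iff hr]
  rw [← ENNReal.rpow_le_rpow_iff hr, rVariation_rpow hd hr hab, powVariation_le_iff]

lemma sum_rpow_le_rVariation (hd : ∀ x, d x x = 0) (hr : 0 < r) (hab : a ≤ b) (n : ℕ)
    {u : ℕ → ℝ} (hu : Monotone u) (hmem : ∀ i, u i ∈ Icc a b) :
    (∑ i ∈ Finset.range n, d (c (u (i + 1))) (c (u i)) ^ r) ^ (1 / r) ≤ rVariation d r a b c :=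
  (rVariation_le_iff hd hr hab).1 le_rfl n u hu hmem

lemma rVariation_self (hd : ∀ x, d x x = 0) (hr : 0 < r) : rVariation d r a a c = 0 := by
  rw [← nonpos_iff_eq_zero, rVariation_le_iff hd hr le_rfl]
  intro n u _ hmem
  simp only [Icc_self, mem_singleton_iff] at hmem
  simp [hmem, hd, hr]

lemma powVariation_mono {a' b' : ℝ} (ha : a' ≤ a) (hb : b ≤ b') :
    powVariation d r a b c ≤ powVariation d r a' b' c :=
  powVariation_le_iff.2 fun n _ hu hmem ↦
    sum_le_powVariation n hu fun i ↦ Icc_subset_Icc ha hb (hmem i)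

lemma rVariation_mono {a' b' : ℝ} (hd : ∀ x, d x x = 0) (hr : 0 < r) (ha : a' ≤ a) (hab : a ≤ b)
    (hb : b ≤ b') : rVariation d r a b c ≤ rVariation d r a' b' c := by
  rw [← ENNReal.rpow_le_rpow_iff hr, rVariation_rpow hd hr hab,
    rVariation_rpow hd hr (ha.trans (hab.trans hb))]
  exact powVariation_mono ha hb

lemma edist_rpow_le_powVariation (hst : s ≤ t) :
    d (c t) (c s) ^ r ≤ powVariation d r s t c := by
  have hu : Monotone fun i : ℕ ↦ if i = 0 then s else t :=
    monotone_nat_of_le_succ fun i ↦ by by_cases h : i = 0 <;> simp [h, hst]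
  simpa using sum_le_powVariation (d := d) (c := c) (r := r) (a := s) (b := t) 1 hu
    fun i ↦ by by_cases h : i = 0 <;> simp [h, hst]

lemma edist_le_rVariation (hd : ∀ x, d x x = 0) (hr : 0 < r) (hst : s ≤ t) :
    d (c t) (c s) ≤ rVariation d r s t c := by
  rw [← ENNReal.rpow_le_rpow_iff hr, rVariation_rpow hd hr hst]
  exact edist_rpow_le_powVariation hst

lemma powVariation_add_le (has : a ≤ s) (hsb : s ≤ b) :
    powVariation d r a s c + powVariation d r s b c ≤ powVariation d r a b c := by
  have : Nonempty {u : ℕ → ℝ // Monotone u ∧ ∀ i, u i ∈ Icc a s} :=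
    ⟨⟨fun _ ↦ a, monotone_const, fun _ ↦ ⟨le_rfl, has⟩⟩⟩
  have : Nonempty {u : ℕ → ℝ // Monotone u ∧ ∀ i, u i ∈ Icc s b} :=
    ⟨⟨fun _ ↦ s, monotone_const, fun _ ↦ ⟨le_rfl, hsb⟩⟩⟩
  refine ENNReal.iSup_add_iSup_le ?_
  rintro ⟨n, ⟨u, hu, us⟩⟩ ⟨m, ⟨v, hv, vt⟩⟩
  let w i := if i ≤ n then u i else v (i - (n + 1))
  have hw : Monotone w := by
    refine monotone_nat_of_le_succ fun i ↦ ?_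
    simp only [w]
    split_ifs with h1 h2
    · exact hu i.le_succ
    · exact (us _).2.trans (vt _).1
    · omega
    · exact hv (by omega)
  have hmem : ∀ i, w i ∈ Icc a b := fun i ↦ by
    simp only [w]
    split_ifs
    · exact Icc_subset_Icc le_rfl hsb (us _)
    · exact Icc_subset_Icc has le_rfl (vt _)
  refine le_trans ?_ (sum_le_powVariation (n + 1 + m) hw hmem)
  rw [Finset.sum_range_add, Finset.sum_range_succ]
  refine add_le_add (le_trans (le_of_eq ?_) le_self_add) (le_of_eq ?_)
  · refine Finset.sum_congr rfl fun i hi ↦ ?_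
    have hin : i < n := Finset.mem_range.1 hi
    simp [w, hin.le, Nat.succ_le_of_lt hin]
  · refine Finset.sum_congr rfl fun i _ ↦ ?_
    have hw_add (k : ℕ) : w (n + 1 + k) = v k := by
      rw [show w (n + 1 + k) = v (n + 1 + k - (n + 1)) from if_neg (by omega),
        Nat.add_sub_cancel_left]
    rw [add_assoc (n + 1), hw_add, hw_add]

lemma sum_powVariation_le {u : ℕ → ℝ} (hu : Monotone u) (n : ℕ) :
    ∑ i ∈ Finset.range n, powVariation d r (u i) (u (i + 1)) c ≤
      powVariation d r (u 0) (u n) c := by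
  induction n with
  | zero => simp
  | succ n ih =>
    rw [Finset.sum_range_succ]
    exact (add_le_add_left ih _).trans (powVariation_add_le (hu n.zero_le) (hu n.le_succ))

lemma edist_le_edist_max_add_edist_min (hd : ∀ x, d x x = 0)
    (htri : ∀ x y z, d x z ≤ d x y + d y z) {u v : ℝ} (huv : u ≤ v) :
    d (c v) (c u) ≤ d (c (max v s)) (c (max u s)) + d (c (min v s)) (c (min u s)) := by
  rcases le_total s u with hu | hu
  · simp [hu, hu.trans huv]
  · rcases le_total s v with hv | hv
    · simpa [hu, hv] using htri _ _ _
    · simp [hu, hv, hd]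

lemma rVariation_le_add (hd : ∀ x, d x x = 0) (htri : ∀ x y z, d x z ≤ d x y + d y z)
    (hr : 1 ≤ r) (has : a ≤ s) (hsb : s ≤ b) :
    rVariation d r a b c ≤ rVariation d r a s c + rVariation d r s b c := by
  have hr0 : 0 < r := by linarith
  refine (rVariation_le_iff hd hr0 (has.trans hsb)).2 fun n u hu hmem ↦ ?_
  calc (∑ i ∈ Finset.range n, d (c (u (i + 1))) (c (u i)) ^ r) ^ (1 / r)
      ≤ (∑ i ∈ Finset.range n, (d (c (max (u (i + 1)) s)) (c (max (u i) s)) +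
        d (c (min (u (i + 1)) s)) (c (min (u i) s))) ^ r) ^ (1 / r) := by
        gcongr with i _
        exact edist_le_edist_max_add_edist_min hd htri (hu i.le_succ)
    _ ≤ _ := ENNReal.Lp_add_le _ _ _ hr
    _ ≤ rVariation d r s b c + rVariation d r a s c := by
        gcongr
        · exact sum_rpow_le_rVariation (u := fun i ↦ max (u i) s) hd hr0 hsb n
            (fun i j hij ↦ max_le_max_right _ (hu hij))
            fun i ↦ ⟨le_max_right _ _, max_le (hmem i).2 hsb⟩
        · exact sum_rpow_le_rVariation (u := fun i ↦ min (u i) s) hd hr0 has n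
            (fun i j hij ↦ min_le_min_right _ (hu hij))
            fun i ↦ ⟨le_min (hmem i).1 has, min_le_right _ _⟩
    _ = rVariation d r a s c + rVariation d r s b c := add_comm _ _

end Variation

section Lipschitz

variable {X : Type*} {d : X → X → ℝ≥0∞} {r a b s t : ℝ} {c : ℝ → X} {M : NNReal}

/-- Lipschitz continuity on `[a, b]` for a distance function that is not an instance. -/
def IsLipschitzOnIcc (d : X → X → ℝ≥0∞) (M : NNReal) (a b : ℝ) (c : ℝ → X) : Prop :=
  ∀ ⦃s t⦄, a ≤ s → s ≤ t → t ≤ b → d (c t) (c s) ≤ M * ENNReal.ofReal (t - s)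

lemma IsLipschitzOnIcc.mono {a' b' : ℝ} (h : IsLipschitzOnIcc d M a b c) (ha : a ≤ a')
    (hb : b' ≤ b) : IsLipschitzOnIcc d M a' b' c :=
  fun _ _ has hst htb ↦ h (ha.trans has) hst (htb.trans hb)

lemma IsLipschitzOnIcc.rVariation_le (h : IsLipschitzOnIcc d M a b c) (hd : ∀ x, d x x = 0)
    (hr : 1 ≤ r) (hab : a ≤ b) :
    rVariation d r a b c ≤ M * ENNReal.ofReal (b - a) := by
  have hr0 : 0 < r := by linarith
  refine (rVariation_le_iff hd hr0 hab).2 fun n u hu hmem ↦ ?_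
  rw [one_div, ENNReal.rpow_inv_le_iff hr0]
  calc ∑ i ∈ Finset.range n, d (c (u (i + 1))) (c (u i)) ^ r
      ≤ ∑ i ∈ Finset.range n, (M * ENNReal.ofReal (u (i + 1) - u i)) ^ r := by
        gcongr with i _
        exact h (hmem i).1 (hu i.le_succ) (hmem _).2
    _ ≤ (∑ i ∈ Finset.range n, M * ENNReal.ofReal (u (i + 1) - u i)) ^ r :=
        sum_rpow_le_rpow_sum _ _ hr
    _ = (M * ENNReal.ofReal (u n - u 0)) ^ r := by
        rw [← Finset.mul_sum, ← ENNReal.ofReal_sum_of_nonneg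
          fun i _ ↦ sub_nonneg.2 (hu i.le_succ), Finset.sum_range_sub]
    _ ≤ (M * ENNReal.ofReal (b - a)) ^ r := by
        gcongr
        · exact (hmem n).2
        · exact (hmem 0).1

lemma IsLipschitzOnIcc.rVariation_ne_top (h : IsLipschitzOnIcc d M a b c) (hd : ∀ x, d x x = 0)
    (hr : 1 ≤ r) (hab : a ≤ b) : rVariation d r a b c ≠ ⊤ :=
  ne_top_of_le_ne_top (ENNReal.mul_ne_top ENNReal.coe_ne_top ENNReal.ofReal_ne_top)
    (h.rVariation_le hd hr hab)

lemma IsLipschitzOnIcc.exists_rVariation_le (h : IsLipschitzOnIcc d M a b c)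
    (hd : ∀ x, d x x = 0) (hr : 1 ≤ r) {δ : ℝ≥0∞} (hδ : δ ≠ 0) :
    ∃ ε > 0, ∀ ⦃s t⦄, a ≤ s → s ≤ t → t ≤ b → t - s ≤ ε → rVariation d r s t c ≤ δ := by
  have hlim : Tendsto (fun ε : ℝ ↦ (M : ℝ≥0∞) * ENNReal.ofReal ε) (𝓝[>] 0) (𝓝 0) := by
    have := ENNReal.Tendsto.const_mul (a := (M : ℝ≥0∞))
      (ENNReal.tendsto_ofReal (tendsto_id (x := 𝓝 (0 : ℝ)))) (Or.inr ENNReal.coe_ne_top)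
    simpa using this.mono_left nhdsWithin_le_nhds
  obtain ⟨ε, hεδ, hε⟩ :=
    ((hlim.eventually_le_const (pos_iff_ne_zero.2 hδ)).and self_mem_nhdsWithin).exists
  refine ⟨ε, hε, fun s t has hst htb hts ↦ ?_⟩
  calc rVariation d r s t c ≤ M * ENNReal.ofReal (t - s) := (h.mono has htb).rVariation_le hd hr hst
    _ ≤ M * ENNReal.ofReal ε := by gcongr
    _ ≤ δ := hεδ

end Lipschitz

section LocalDomination

variable {V W : ℕ → ℕ → ℝ≥0∞} {B θ : ℝ≥0∞}

/- Greedy covering: from `i`, jump to the last point with `W ≤ θ` and then one step further. Each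
such jump costs at most `2 * B` in `V` and uses up more than `θ` of `W`. -/
lemma mul_le_of_superadditive_of_subadditive
    (hV : ∀ i j k, i ≤ j → j ≤ k → V i k ≤ V i j + V j k)
    (hW : ∀ i j k, i ≤ j → j ≤ k → W i j + W j k ≤ W i k)
    (hVW : ∀ i j, i ≤ j → W i j ≤ θ → V i j ≤ B) (hstep : ∀ i, W i (i + 1) ≤ θ) (m i : ℕ) :
    θ * V i (i + m) ≤ B * (2 * W i (i + m) + θ) := by
  induction m using Nat.strong_induction_on generalizing i with
  | _ m ih =>
    by_cases hm : W i (i + m) ≤ θ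
    · calc θ * V i (i + m) ≤ θ * B := by gcongr; exact hVW _ _ (by omega) hm
        _ = B * θ := mul_comm _ _
        _ ≤ B * (2 * W i (i + m) + θ) := by gcongr; exact le_add_self
    · have hself : W i i ≤ θ :=
        (le_self_add.trans (hW i i (i + 1) le_rfl (by omega))).trans (hstep i)
      obtain ⟨j, hj, hj'⟩ := Nat.exists_not_and_succ_of_not_zero_of_exists
        (p := fun j ↦ θ < W i (i + j)) (by simpa using hself) ⟨m, not_le.1 hm⟩
      have hjm : j + 1 ≤ m := by
        by_contra! hmj
        exact hm <| (le_self_add.trans (hW i (i + m) (i + j) (by omega) (by omega))).trans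
          (not_lt.1 hj)
      obtain ⟨l, rfl⟩ := Nat.exists_eq_add_of_le hjm
      rw [show i + (j + 1 + l) = i + (j + 1) + l by omega]
      calc θ * V i (i + (j + 1) + l)
          ≤ θ * (V i (i + j) + V (i + j) (i + j + 1) + V (i + (j + 1)) (i + (j + 1) + l)) := by
            gcongr
            refine (hV i (i + (j + 1)) _ (by omega) (by omega)).trans ?_
            gcongr
            exact hV _ _ _ (by omega) (by omega)
        _ = θ * V i (i + j) + θ * V (i + j) (i + j + 1) +
            θ * V (i + (j + 1)) (i + (j + 1) + l) := by ring
        _ ≤ θ * B + θ * B + B * (2 * W (i + (j + 1)) (i + (j + 1) + l) + θ) := by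
            refine add_le_add (add_le_add ?_ ?_) (ih l (by omega) _)
            · gcongr; exact hVW _ _ (by omega) (not_lt.1 hj)
            · gcongr; exact hVW _ _ (by omega) (hstep _)
        _ = B * (2 * (θ + W (i + (j + 1)) (i + (j + 1) + l)) + θ) := by ring
        _ ≤ B * (2 * W i (i + (j + 1) + l) + θ) := by
            gcongr
            exact (add_le_add_left hj'.le _).trans (hW _ _ _ (by omega) (by omega))

variable {X Y : Type*} {d₁ : X → X → ℝ≥0∞} {d₂ : Y → Y → ℝ≥0∞} {r a b s t : ℝ}
  {c₁ : ℝ → X} {c₂ : ℝ → Y} {δ K : ℝ≥0∞} {M : NNReal}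

/-- Local domination of the increments of `c₁` by those of `c₂` over `[a, b]`, up to an error
quadratic in the variation of `c₂` and on the subintervals where this variation is at most `δ`. -/
def IsLocallyDominated (d₁ : X → X → ℝ≥0∞) (d₂ : Y → Y → ℝ≥0∞) (r a b : ℝ) (c₁ : ℝ → X)
    (c₂ : ℝ → Y) (δ K : ℝ≥0∞) : Prop :=
  ∀ ⦃s t⦄, a ≤ s → s ≤ t → t ≤ b → rVariation d₂ r s t c₂ ≤ δ →
    d₁ (c₁ t) (c₁ s) ≤ d₂ (c₂ t) (c₂ s) + K * rVariation d₂ r s t c₂ ^ 2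

lemma sum_rVariation_sq_rpow_le (hd₂ : ∀ x, d₂ x x = 0) (hr : 0 < r) (hst : s ≤ t) {u : ℕ → ℝ}
    (hu : Monotone u) (hmem : ∀ i, u i ∈ Icc s t) (n : ℕ) :
    ∑ i ∈ Finset.range n, (rVariation d₂ r (u i) (u (i + 1)) c₂ ^ 2) ^ r ≤
      (rVariation d₂ r s t c₂ ^ 2) ^ r := by
  have hswap {u v : ℝ} (huv : u ≤ v) :
      (rVariation d₂ r u v c₂ ^ 2) ^ r = powVariation d₂ r u v c₂ ^ (2 : ℝ) := by
    rw [← rVariation_rpow hd₂ hr huv, ← ENNReal.rpow_mul, mul_comm, ENNReal.rpow_mul,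
      ENNReal.rpow_two]
  rw [hswap hst, Finset.sum_congr rfl fun i _ ↦ hswap (hu i.le_succ)]
  refine (sum_rpow_le_rpow_sum _ _ one_le_two).trans ?_
  gcongr
  exact (sum_powVariation_le hu n).trans (powVariation_mono (hmem 0).1 (hmem n).2)

lemma IsLocallyDominated.rVariation_le_add_mul_sq (h : IsLocallyDominated d₁ d₂ r a b c₁ c₂ δ K)
    (hd₁ : ∀ x, d₁ x x = 0) (hd₂ : ∀ x, d₂ x x = 0) (hr : 1 ≤ r) (has : a ≤ s) (hst : s ≤ t)
    (htb : t ≤ b) (hδ : rVariation d₂ r s t c₂ ≤ δ) :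
    rVariation d₁ r s t c₁ ≤ rVariation d₂ r s t c₂ + K * rVariation d₂ r s t c₂ ^ 2 := by
  have hr0 : 0 < r := by linarith
  refine (rVariation_le_iff hd₁ hr0 hst).2 fun n u hu hmem ↦ ?_
  calc (∑ i ∈ Finset.range n, d₁ (c₁ (u (i + 1))) (c₁ (u i)) ^ r) ^ (1 / r)
      ≤ (∑ i ∈ Finset.range n, (d₂ (c₂ (u (i + 1))) (c₂ (u i)) +
        K * rVariation d₂ r (u i) (u (i + 1)) c₂ ^ 2) ^ r) ^ (1 / r) := by
        gcongr with i _
        exact h (has.trans (hmem i).1) (hu i.le_succ) ((hmem _).2.trans htb)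
          ((rVariation_mono hd₂ hr0 (hmem i).1 (hu i.le_succ) (hmem _).2).trans hδ)
    _ ≤ (∑ i ∈ Finset.range n, d₂ (c₂ (u (i + 1))) (c₂ (u i)) ^ r) ^ (1 / r) +
        (∑ i ∈ Finset.range n, (K * rVariation d₂ r (u i) (u (i + 1)) c₂ ^ 2) ^ r) ^ (1 / r) :=
        ENNReal.Lp_add_le _ _ _ hr
    _ ≤ rVariation d₂ r s t c₂ + K * rVariation d₂ r s t c₂ ^ 2 := by
        gcongr
        · exact sum_rpow_le_rVariation hd₂ hr0 hst n hu hmem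
        · rw [one_div, ENNReal.rpow_inv_le_iff hr0, ENNReal.mul_rpow_of_nonneg _ _ hr0.le]
          simp_rw [ENNReal.mul_rpow_of_nonneg _ _ hr0.le]
          rw [← Finset.mul_sum]
          gcongr
          exact sum_rVariation_sq_rpow_le hd₂ hr0 hst hu hmem n

lemma IsLocallyDominated.rpow_mul_rVariation_le
    (h : IsLocallyDominated d₁ d₂ r a b c₁ c₂ δ K) (hd₁ : ∀ x, d₁ x x = 0)
    (htri : ∀ x y z, d₁ x z ≤ d₁ x y + d₁ y z) (hd₂ : ∀ x, d₂ x x = 0) (hr : 1 ≤ r)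
    (hδ : δ ≠ 0) (hδ1 : δ ≤ 1) (hab : a ≤ b) (hlip : IsLipschitzOnIcc d₂ M a b c₂) :
    δ ^ r * rVariation d₁ r a b c₁ ≤ (1 + K) * (2 * rVariation d₂ r a b c₂ ^ r + δ ^ r) := by
  have hr0 : 0 < r := by linarith
  obtain ⟨ε, hε, hfine⟩ := hlip.exists_rVariation_le hd₂ hr hδ
  let g (i : ℕ) : Icc a b := Icc.addNSMul hab ε i
  obtain ⟨n, hn⟩ := Icc.addNSMul_eq_right hab hε
  have hg : Monotone g := Icc.monotone_addNSMul hab hε.le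
  have hpow {i j : ℕ} (hij : i ≤ j) :
      powVariation d₂ r (g i) (g j) c₂ ≤ δ ^ r ↔ rVariation d₂ r (g i) (g j) c₂ ≤ δ := by
    rw [← rVariation_rpow hd₂ hr0 (hg hij), ENNReal.rpow_le_rpow_iff hr0]
  have hcover := mul_le_of_superadditive_of_subadditive
    (V := fun i j ↦ rVariation d₁ r (g i) (g j) c₁)
    (W := fun i j ↦ powVariation d₂ r (g i) (g j) c₂) (B := 1 + K) (θ := δ ^ r)
    (fun i j k hij hjk ↦ rVariation_le_add hd₁ htri hr (hg hij) (hg hjk))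
    (fun i j k hij hjk ↦ powVariation_add_le (hg hij) (hg hjk))
    (fun i j hij hW ↦ by
      have hle := (hpow hij).1 hW
      refine (h.rVariation_le_add_mul_sq hd₁ hd₂ hr (g i).2.1 (hg hij) (g j).2.2 hle).trans ?_
      gcongr
      · exact hle.trans hδ1
      · exact mul_le_of_le_one_right' (pow_le_one' (hle.trans hδ1) 2))
    (fun i ↦ (hpow i.le_succ).2 <| hfine (g i).2.1 (hg i.le_succ) (g (i + 1)).2.2 <|
      (le_abs_self _).trans <|
        Icc.abs_sub_addNSMul_le hab hε.le i ⟨hg i.le_succ, le_rfl⟩)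
    n 0
  rw [rVariation_rpow hd₂ hr0 hab]
  simpa only [zero_add, g, Icc.addNSMul_zero, hn n le_rfl] using hcover

lemma rpow_div_rpow_le_min_div_sq {v : ℝ≥0∞} (hr : 0 < r) (hr2 : r ≤ 2) (hδ : δ ≠ 0)
    (hδ1 : δ ≤ 1) (hδv : δ ≤ v) : v ^ r / δ ^ r ≤ min (v ^ 2) (v ^ r) / δ ^ 2 := by
  have hδtop : δ ≠ ⊤ := ne_top_of_le_ne_top ENNReal.one_ne_top hδ1
  rcases min_cases (v ^ 2) (v ^ r) with ⟨hmin, -⟩ | ⟨hmin, -⟩ <;> rw [hmin]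
  · rw [← ENNReal.rpow_two, ← ENNReal.rpow_two, ← ENNReal.div_rpow_of_nonneg _ _ hr.le,
      ← ENNReal.div_rpow_of_nonneg _ _ zero_le_two]
    refine ENNReal.rpow_le_rpow_of_exponent_le ?_ hr2
    rwa [ENNReal.le_div_iff_mul_le (Or.inl hδ) (Or.inl hδtop), one_mul]
  · rw [← ENNReal.rpow_two]
    exact ENNReal.div_le_div_left (ENNReal.rpow_le_rpow_of_exponent_ge hδ1 hr2) _

theorem IsLocallyDominated.rVariation_le (h : IsLocallyDominated d₁ d₂ r a b c₁ c₂ δ K)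
    (hd₁ : ∀ x, d₁ x x = 0) (htri : ∀ x y z, d₁ x z ≤ d₁ x y + d₁ y z) (hd₂ : ∀ x, d₂ x x = 0)
    (hr : 1 ≤ r) (hr2 : r ≤ 2) (hδ : δ ≠ 0) (hδ1 : δ ≤ 1) (hab : a ≤ b)
    (hlip : IsLipschitzOnIcc d₂ M a b c₂) :
    rVariation d₁ r a b c₁ ≤ rVariation d₂ r a b c₂ + 3 * (1 + K) / δ ^ 2 *
      min (rVariation d₂ r a b c₂ ^ 2) (rVariation d₂ r a b c₂ ^ r) := by
  have hr0 : 0 < r := by linarith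
  set v := rVariation d₂ r a b c₂
  rcases le_or_gt v δ with hv | hv
  · refine (h.rVariation_le_add_mul_sq hd₁ hd₂ hr le_rfl hab le_rfl hv).trans ?_
    gcongr
    · have h13 : (1 : ℝ≥0∞) ≤ 3 := by norm_num
      calc K ≤ 3 * (1 + K) := by simpa using mul_le_mul' h13 (le_add_self (a := K) (b := 1))
        _ ≤ 3 * (1 + K) / δ ^ 2 := by
            simpa using ENNReal.div_le_div_left (pow_le_one' hδ1 2) (3 * (1 + K))
    · refine le_min le_rfl ?_
      rw [← ENNReal.rpow_two]
      exact ENNReal.rpow_le_rpow_of_exponent_ge (hv.trans hδ1) hr2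
  · have hδtop : δ ≠ ⊤ := ne_top_of_le_ne_top ENNReal.one_ne_top hδ1
    have hδr : δ ^ r ≠ 0 := by simp [hδ, hδtop]
    have hδrtop : δ ^ r ≠ ⊤ := by simp [hδ, hδtop]
    refine le_trans ?_ le_add_self
    calc rVariation d₁ r a b c₁ ≤ 3 * (1 + K) * v ^ r / δ ^ r := by
          rw [ENNReal.le_div_iff_mul_le (Or.inl hδr) (Or.inl hδrtop), mul_comm]
          refine (h.rpow_mul_rVariation_le hd₁ htri hd₂ hr hδ hδ1 hab hlip).trans ?_
          calc (1 + K) * (2 * v ^ r + δ ^ r) ≤ (1 + K) * (2 * v ^ r + v ^ r) := by gcongr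
            _ = 3 * (1 + K) * v ^ r := by ring
      _ = 3 * (1 + K) * (v ^ r / δ ^ r) := mul_div_assoc _ _ _
      _ ≤ 3 * (1 + K) * (min (v ^ 2) (v ^ r) / δ ^ 2) :=
          mul_le_mul_right (rpow_div_rpow_le_min_div_sq hr0 hr2 hδ hδ1 hv.le) _
      _ = 3 * (1 + K) / δ ^ 2 * min (v ^ 2) (v ^ r) := by
          simp only [div_eq_mul_inv]
          ring

lemma exists_rVariation_le_of_isLocallyDominated (hd₁ : ∀ x, d₁ x x = 0)
    (htri : ∀ x y z, d₁ x z ≤ d₁ x y + d₁ y z) (hd₂ : ∀ x, d₂ x x = 0) (hr : 1 ≤ r) (hr2 : r ≤ 2)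
    {δ K : ℝ} (hδ : 0 < δ) (hδ1 : δ ≤ 1) :
    ∃ D : NNReal, ∀ ⦃a b M c₁ c₂⦄,
      IsLocallyDominated d₁ d₂ r a b c₁ c₂ (ENNReal.ofReal δ) (ENNReal.ofReal K) →
      IsLipschitzOnIcc d₂ M a b c₂ → a ≤ b → rVariation d₁ r a b c₁ ≤ rVariation d₂ r a b c₂ +
        D * min (rVariation d₂ r a b c₂ ^ 2) (rVariation d₂ r a b c₂ ^ r) := by
  have hδ0 : ENNReal.ofReal δ ≠ 0 := by simpa using hδ
  refine ⟨(3 * (1 + ENNReal.ofReal K) / ENNReal.ofReal δ ^ 2).toNNReal,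
    fun a b M c₁ c₂ h hlip hab ↦ ?_⟩
  rw [ENNReal.coe_toNNReal (by finiteness)]
  exact h.rVariation_le hd₁ htri hd₂ hr hr2 hδ0 (by simpa using hδ1) hab hlip

end LocalDomination

section Control

variable {α β : Type*} [Preorder α] [Preorder β]

/-- A control in the sense of rough path theory: a nonnegative superadditive function of the
intervals with endpoints in `S`. -/
structure IsControlOn (Ω : α → α → ℝ) (S : Set α) : Prop where
  nonneg : ∀ ⦃u w⦄, u ∈ S → w ∈ S → u ≤ w → 0 ≤ Ω u w
  add_le : ∀ ⦃u v w⦄, u ∈ S → v ∈ S → w ∈ S → u ≤ v → v ≤ w → Ω u v + Ω v w ≤ Ω u w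

namespace IsControlOn

variable {Ω Ω' : α → α → ℝ} {S : Set α}

lemma self_eq_zero (h : IsControlOn Ω S) {u : α} (hu : u ∈ S) : Ω u u = 0 := by
  linarith [h.nonneg hu hu le_rfl, h.add_le hu hu hu le_rfl le_rfl]

lemma mono (h : IsControlOn Ω S) {u v v' w : α} (hu : u ∈ S) (hv : v ∈ S) (hv' : v' ∈ S)
    (hw : w ∈ S) (huv : u ≤ v) (hvv' : v ≤ v') (hvw : v' ≤ w) : Ω v v' ≤ Ω u w := by
  linarith [h.add_le hu hv hv' huv hvv', h.add_le hu hv' hw (huv.trans hvv') hvw,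
    h.nonneg hu hv huv, h.nonneg hv' hw hvw]

lemma comp_monotone (h : IsControlOn Ω S) {f : β → α} (hf : Monotone f) (hfS : ∀ i, f i ∈ S) :
    IsControlOn (fun i j ↦ Ω (f i) (f j)) univ where
  nonneg _ _ _ _ hij := h.nonneg (hfS _) (hfS _) (hf hij)
  add_le _ _ _ _ _ _ hij hjk := h.add_le (hfS _) (hfS _) (hfS _) (hf hij) (hf hjk)

lemma add (h : IsControlOn Ω S) (h' : IsControlOn Ω' S) :
    IsControlOn (fun u w ↦ Ω u w + Ω' u w) S where
  nonneg _ _ hu hw huw := add_nonneg (h.nonneg hu hw huw) (h'.nonneg hu hw huw)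
  add_le _ _ _ hu hv hw huv hvw := by
    linarith [h.add_le hu hv hw huv hvw, h'.add_le hu hv hw huv hvw]

lemma const_mul_sub {ε : ℝ} (hε : 0 ≤ ε) (S : Set ℝ) : IsControlOn (fun u w ↦ ε * (w - u)) S where
  nonneg _ _ _ _ huw := mul_nonneg hε (sub_nonneg.2 huw)
  add_le _ _ _ _ _ _ _ _ := by rw [← mul_add, sub_add_sub_cancel']

lemma exists_le_half_and_le_half {Ω : ℕ → ℕ → ℝ} (hΩ : IsControlOn Ω univ) {i k : ℕ}
    (hik : i < k) :
    ∃ j, i ≤ j ∧ j < k ∧ Ω i j ≤ Ω i k / 2 ∧ Ω (j + 1) k ≤ Ω i k / 2 := by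
  have hnonneg : 0 ≤ Ω i k := hΩ.nonneg trivial trivial hik.le
  obtain ⟨n, hn, hn'⟩ := Nat.exists_not_and_succ_of_not_zero_of_exists
    (p := fun n ↦ Ω i k / 2 < Ω i (i + n) ∨ k ≤ i + n)
    (by simp only [add_zero, hΩ.self_eq_zero (mem_univ i), not_or]; exact ⟨by linarith, by omega⟩)
    ⟨k - i, Or.inr (by omega)⟩
  obtain ⟨hleft, hnk⟩ := not_or.1 hn
  refine ⟨i + n, by omega, not_le.1 hnk, not_lt.1 hleft, ?_⟩
  rcases hn' with hhalf | hk
  · have := hΩ.add_le (mem_univ i) (mem_univ (i + (n + 1))) (mem_univ k) (by omega) (by omega)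
    rw [add_assoc]
    linarith
  · rw [show i + n + 1 = k by omega, hΩ.self_eq_zero (mem_univ k)]
    linarith

end IsControlOn

lemma exists_isControlOn_of_rVariation_ne_top {X : Type*} {d : X → X → ℝ≥0∞} {r s t : ℝ}
    {c : ℝ → X} (hd : ∀ x, d x x = 0) (hr : 0 < r) (hst : s ≤ t)
    (hfin : rVariation d r s t c ≠ ⊤) :
    ∃ Ω : ℝ → ℝ → ℝ, IsControlOn Ω (Icc s t) ∧ Ω s t ^ (1 / r) = (rVariation d r s t c).toReal ∧
      ∀ u ∈ Icc s t, ∀ w ∈ Icc s t, u ≤ w → d (c w) (c u) ≤ ENNReal.ofReal (Ω u w ^ (1 / r)) := by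
  have hsub {u w : ℝ} (hu : u ∈ Icc s t) (hw : w ∈ Icc s t) : powVariation d r u w c ≠ ⊤ := by
    refine ne_top_of_le_ne_top ?_ (powVariation_mono hu.1 hw.2)
    rw [← rVariation_rpow hd hr hst]
    exact ENNReal.rpow_ne_top_of_nonneg hr.le hfin
  refine ⟨fun u w ↦ (powVariation d r u w c).toReal,
    ⟨fun _ _ _ _ _ ↦ ENNReal.toReal_nonneg, fun u v w hu hv hw huv hvw ↦ ?_⟩, ?_,
    fun u hu w hw huw ↦ ?_⟩
  · rw [← ENNReal.toReal_add (hsub hu hv) (hsub hv hw)]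
    exact ENNReal.toReal_mono (hsub hu hw) (powVariation_add_le huv hvw)
  · simp only [ENNReal.toReal_rpow, ← rVariation_rpow hd hr hst, one_div,
      ENNReal.rpow_rpow_inv hr.ne']
  · rw [← ENNReal.ofReal_rpow_of_nonneg ENNReal.toReal_nonneg (by positivity),
      ENNReal.ofReal_toReal (hsub hu hw), one_div, ENNReal.le_rpow_inv_iff hr]
    exact edist_rpow_le_powVariation huw

end Control

section Sewing

/-- The constant in the sewing estimate for errors bounded by the square of `Ω ^ p`. -/
def sewingConst (p A C : ℝ) : ℝ := 4 * C * A ^ 2 / (1 - 2 ^ (1 - 2 * p))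

lemma one_sub_two_rpow_pos {p : ℝ} (hp : 1 / 2 < p) : 0 < 1 - (2 : ℝ) ^ (1 - 2 * p) :=
  sub_pos.2 (Real.rpow_lt_one_of_one_lt_of_neg one_lt_two (by linarith))

lemma sewingConst_nonneg {p A C : ℝ} (hp : 1 / 2 < p) (hC : 0 ≤ C) : 0 ≤ sewingConst p A C :=
  div_nonneg (by positivity) (one_sub_two_rpow_pos hp).le

lemma four_mul_add_sewingConst_mul_le {p A C w y z : ℝ} (hp : 1 / 2 < p) (hC : 0 ≤ C)
    (hy : 0 ≤ y) (hyw : y ≤ w / 2) (hz : 0 ≤ z) (hzw : z ≤ w / 2) :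
    4 * C * (A * w ^ p) ^ 2 + sewingConst p A C * (y ^ p) ^ 2 + sewingConst p A C * (z ^ p) ^ 2 ≤
      sewingConst p A C * (w ^ p) ^ 2 := by
  have hw : 0 ≤ w := by linarith
  have hhalf {v : ℝ} (hv : 0 ≤ v) (hvw : v ≤ w / 2) :
      sewingConst p A C * (v ^ p) ^ 2 ≤
        sewingConst p A C * (2 ^ (1 - 2 * p) / 2 * (w ^ p) ^ 2) := by
    refine mul_le_mul_of_nonneg_left ?_ (sewingConst_nonneg hp hC)
    calc (v ^ p) ^ 2 ≤ ((w / 2) ^ p) ^ 2 := by gcongr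
      _ = 2 ^ (1 - 2 * p) / 2 * (w ^ p) ^ 2 := by
        rw [Real.div_rpow hw zero_le_two, div_pow, Real.rpow_sub two_pos, Real.rpow_one,
          mul_comm 2 p, Real.rpow_mul zero_le_two, Real.rpow_two]
        ring
  have hconst : sewingConst p A C * (1 - 2 ^ (1 - 2 * p)) = 4 * C * A ^ 2 :=
    div_mul_cancel₀ _ (one_sub_two_rpow_pos hp).ne'
  linear_combination hhalf hy hyw + hhalf hz hzw - (w ^ p) ^ 2 * hconst

variable {G E : Type*} [Group G] [NormedAddCommGroup E]

/-- A map `L` behaving on a neighbourhood `V` of the identity like the logarithm of a Lie group on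
the preimage of the ball of radius `ρ`: it is additive up to a quadratic error, and products of
elements of `V` stay in `V` as long as their image under `L` has norm less than `ρ`. -/
structure IsLocalLogarithm (L : G → E) (V : Set G) (C ρ : ℝ) : Prop where
  nonneg : 0 ≤ C
  one_mem : 1 ∈ V
  map_one : L 1 = 0
  norm_map_mul_sub_le : ∀ ⦃g⦄, g ∈ V → ∀ ⦃h⦄, h ∈ V → ‖L (g * h) - L g - L h‖ ≤ C * ‖L g‖ * ‖L h‖
  mul_mem : ∀ ⦃g⦄, g ∈ V → ∀ ⦃h⦄, h ∈ V → ‖L (g * h)‖ < ρ → g * h ∈ V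

namespace IsLocalLogarithm

variable {L : G → E} {V : Set G} {C ρ : ℝ}

lemma mul_mul_mem_and_norm_sub_le (hL : IsLocalLogarithm L V C ρ) {a u b : G} {l : ℝ}
    (ha : a ∈ V) (hu : u ∈ V) (hb : b ∈ V) (hal : ‖L a‖ ≤ l) (hul : ‖L u‖ ≤ l) (hbl : ‖L b‖ ≤ l)
    (hCl : C * l ≤ 1) (hρ : 7 * l < ρ) :
    a * u * b ∈ V ∧ ‖L (a * u * b) - (L a + L u + L b)‖ ≤ 4 * C * l ^ 2 := by
  have hC := hL.nonneg
  have hl : 0 ≤ l := (norm_nonneg _).trans hal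
  have hsq : C * l ^ 2 ≤ l := by nlinarith
  have hau : ‖L (a * u) - L a - L u‖ ≤ C * l ^ 2 := by
    calc ‖L (a * u) - L a - L u‖ ≤ C * ‖L a‖ * ‖L u‖ := hL.norm_map_mul_sub_le ha hu
      _ ≤ C * l * l := by gcongr
      _ = C * l ^ 2 := by ring
  have hau' : ‖L (a * u)‖ ≤ 3 * l := by
    calc ‖L (a * u)‖ = ‖(L (a * u) - L a - L u) + L a + L u‖ := by congr 1; abel
      _ ≤ ‖L (a * u) - L a - L u‖ + ‖L a‖ + ‖L u‖ := norm_add₃_le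
      _ ≤ 3 * l := by linarith
  have hauV : a * u ∈ V := hL.mul_mem ha hu (by linarith)
  have haub : ‖L (a * u * b) - L (a * u) - L b‖ ≤ 3 * (C * l ^ 2) := by
    calc ‖L (a * u * b) - L (a * u) - L b‖ ≤ C * ‖L (a * u)‖ * ‖L b‖ :=
          hL.norm_map_mul_sub_le hauV hb
      _ ≤ C * (3 * l) * l := by gcongr
      _ = 3 * (C * l ^ 2) := by ring
  refine ⟨hL.mul_mem hauV hb ?_, ?_⟩
  · calc ‖L (a * u * b)‖ = ‖(L (a * u * b) - L (a * u) - L b) + L (a * u) + L b‖ := by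
          congr 1; abel
      _ ≤ ‖L (a * u * b) - L (a * u) - L b‖ + ‖L (a * u)‖ + ‖L b‖ := norm_add₃_le
      _ < ρ := by linarith
  · calc ‖L (a * u * b) - (L a + L u + L b)‖
        = ‖(L (a * u * b) - L (a * u) - L b) + (L (a * u) - L a - L u)‖ := by congr 1; abel
      _ ≤ ‖L (a * u * b) - L (a * u) - L b‖ + ‖L (a * u) - L a - L u‖ := norm_add_le _ _
      _ ≤ 4 * C * l ^ 2 := by linarith

lemma mul_mul_mem_and_norm_sub_le_sewingConst (hL : IsLocalLogarithm L V C ρ) {a u b : G}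
    {xa xu xb : E} {A p w y z ea eu eb : ℝ} (hp : 1 / 2 < p)
    (ha : a ∈ V) (hu : u ∈ V) (hb : b ∈ V)
    (hal : ‖L a‖ ≤ A * w ^ p) (hul : ‖L u‖ ≤ A * w ^ p) (hbl : ‖L b‖ ≤ A * w ^ p)
    (hCw : C * (A * w ^ p) ≤ 1) (hρ : 7 * (A * w ^ p) < ρ)
    (hy : 0 ≤ y) (hyw : y ≤ w / 2) (hz : 0 ≤ z) (hzw : z ≤ w / 2)
    (hxa : ‖L a - xa‖ ≤ sewingConst p A C * (y ^ p) ^ 2 + ea) (hxu : ‖L u - xu‖ ≤ eu)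
    (hxb : ‖L b - xb‖ ≤ sewingConst p A C * (z ^ p) ^ 2 + eb) :
    a * u * b ∈ V ∧
      ‖L (a * u * b) - (xa + xu + xb)‖ ≤ sewingConst p A C * (w ^ p) ^ 2 + (ea + eu + eb) := by
  obtain ⟨hV, hadd⟩ := hL.mul_mul_mem_and_norm_sub_le ha hu hb hal hul hbl hCw hρ
  refine ⟨hV, ?_⟩
  calc ‖L (a * u * b) - (xa + xu + xb)‖
      = ‖(L (a * u * b) - (L a + L u + L b)) + (L a - xa) + (L u - xu) + (L b - xb)‖ := by
        congr 1; abel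
    _ ≤ ‖L (a * u * b) - (L a + L u + L b)‖ + ‖L a - xa‖ + ‖L u - xu‖ + ‖L b - xb‖ :=
        norm_add₄_le
    _ ≤ sewingConst p A C * (w ^ p) ^ 2 + (ea + eu + eb) := by
        linarith [four_mul_add_sewingConst_mul_le (A := A) hp hL.nonneg hy hyw hz hzw]

/-- The induction bisects the interval along the control: both halves carry at most half of `Ω`,
hence at most a fraction `2 ^ (-2 * p) < 1 / 2` of the error. -/
theorem sewing (hL : IsLocalLogarithm L V C ρ) {A p δ : ℝ} (hA : 0 ≤ A) (hp : 1 / 2 < p)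
    (hCδ : C * (A * δ) ≤ 1) (hρδ : 7 * (A * δ) < ρ)
    {g : ℕ → G} {x : ℕ → E} {e : ℕ → ℝ} {Ω : ℕ → ℕ → ℝ} (hΩ : IsControlOn Ω univ)
    (hΩδ : ∀ ⦃i j⦄, i ≤ j → Ω i j ^ p ≤ δ)
    (hsmall : ∀ ⦃i j⦄, i ≤ j → (g i)⁻¹ * g j ∈ V →
      ‖L ((g i)⁻¹ * g j) - (x j - x i)‖ ≤ sewingConst p A C * (Ω i j ^ p) ^ 2 + (e j - e i) →
      ‖L ((g i)⁻¹ * g j)‖ ≤ A * Ω i j ^ p)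
    (hstep : ∀ i, (g i)⁻¹ * g (i + 1) ∈ V ∧
      ‖L ((g i)⁻¹ * g (i + 1)) - (x (i + 1) - x i)‖ ≤ e (i + 1) - e i) (m i : ℕ) :
    (g i)⁻¹ * g (i + m) ∈ V ∧ ‖L ((g i)⁻¹ * g (i + m)) - (x (i + m) - x i)‖ ≤
      sewingConst p A C * (Ω i (i + m) ^ p) ^ 2 + (e (i + m) - e i) := by
  have hK := sewingConst_nonneg (A := A) hp hL.nonneg
  induction m using Nat.strong_induction_on generalizing i with
  | _ m ih =>
    rcases m.eq_zero_or_pos with rfl | hm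
    · simp only [add_zero, inv_mul_cancel, hL.map_one, sub_self, norm_zero]
      exact ⟨hL.one_mem, by positivity⟩
    obtain ⟨j, hij, hjm, hleft, hright⟩ := hΩ.exists_le_half_and_le_half (show i < i + m by omega)
    obtain ⟨n, rfl⟩ := Nat.exists_eq_add_of_le hij
    obtain ⟨q, hq⟩ := Nat.exists_eq_add_of_le (show i + n + 1 ≤ i + m by omega)
    rw [hq] at hleft hright ⊢
    obtain ⟨haV, ha⟩ := ih n (by omega) i
    obtain ⟨hbV, hb⟩ := ih q (by omega) (i + n + 1)
    obtain ⟨huV, hu⟩ := hstep (i + n)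
    have hle {i' j' : ℕ} (h₁ : i ≤ i') (h₂ : i' ≤ j') (h₃ : j' ≤ i + n + 1 + q) :
        A * Ω i' j' ^ p ≤ A * Ω i (i + n + 1 + q) ^ p := by
      gcongr
      · exact hΩ.nonneg trivial trivial h₂
      · exact hΩ.mono trivial trivial trivial trivial h₁ h₂ h₃
    have hAδ := mul_le_mul_of_nonneg_left (hΩδ (show i ≤ i + n + 1 + q by omega)) hA
    have hjoin := hL.mul_mul_mem_and_norm_sub_le_sewingConst hp haV huV hbV
      ((hsmall (by omega) haV ha).trans (hle le_rfl (by omega) (by omega)))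
      ((hsmall (by omega) huV (hu.trans (le_add_of_nonneg_left (by positivity)))).trans
        (hle (by omega) (by omega) (by omega)))
      ((hsmall (by omega) hbV hb).trans (hle (by omega) (by omega) le_rfl))
      ((mul_le_mul_of_nonneg_left hAδ hL.nonneg).trans hCδ) (by linarith)
      (hΩ.nonneg trivial trivial (by omega)) hleft (hΩ.nonneg trivial trivial (by omega)) hright
      ha hu hb
    convert! hjoin using 2
    · group
    · rw [show (g i)⁻¹ * g (i + n + 1 + q) = (g i)⁻¹ * g (i + n) *
        ((g (i + n))⁻¹ * g (i + n + 1)) * ((g (i + n + 1))⁻¹ * g (i + n + 1 + q)) by group]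
      congr 2
      abel
    · ring

end IsLocalLogarithm

end Sewing

section Tangency

variable {G E : Type*} [Group G] [NormedAddCommGroup E]

/-- The increments of `γ` on `[s, t]`, read through `L`, agree with those of `x` up to an error
`o(w - u)`, uniformly in the interval `[u, w]`. -/
def IsTangentOn (L : G → E) (V : Set G) (γ : ℝ → G) (x : ℝ → E) (s t : ℝ) : Prop :=
  ∀ ε > 0, ∃ h > 0, ∀ ⦃u w⦄, s ≤ u → u ≤ w → w ≤ t → w - u ≤ h →
    (γ u)⁻¹ * γ w ∈ V ∧ ‖L ((γ u)⁻¹ * γ w) - (x w - x u)‖ ≤ ε * (w - u)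

lemma IsTangentOn.mono {L : G → E} {V : Set G} {γ : ℝ → G} {x : ℝ → E} {a b s t : ℝ}
    (h : IsTangentOn L V γ x a b) (has : a ≤ s) (htb : t ≤ b) : IsTangentOn L V γ x s t :=
  fun ε hε ↦ (h ε hε).imp fun _ hh ↦
    ⟨hh.1, fun _ _ hsu huw hwt ↦ hh.2 (has.trans hsu) huw (hwt.trans htb)⟩

lemma le_add_two_mul_rpow_of_min_le {A K p l n e q c : ℝ} (hA : 0 ≤ A) (hp : 0 < p) (hp1 : p ≤ 1)
    (hc : 0 ≤ c) (he : 0 ≤ e) (hq : c + e = q) (hq1 : q ^ p ≤ 1) (hKq : K * q ^ p ≤ 1)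
    (hmin : min l n ≤ A * c ^ p) (hln : l ≤ n + (K * (q ^ p) ^ 2 + e)) : l ≤ (A + 2) * q ^ p := by
  have hq0 : 0 ≤ q := by linarith
  have hqp : 0 ≤ q ^ p := Real.rpow_nonneg hq0 p
  have hle_one : q ≤ 1 := (Real.rpow_le_rpow_iff hq0 zero_le_one hp).1 (by rwa [Real.one_rpow])
  have he_le : e ≤ q ^ p :=
    (by linarith : e ≤ q).trans (Real.self_le_rpow_of_le_one hq0 hle_one hp1)
  have hK_le : K * (q ^ p) ^ 2 ≤ q ^ p := by nlinarith
  have hc_le : A * c ^ p ≤ A * q ^ p := by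
    gcongr
    linarith
  rcases min_le_iff.1 hmin with hl | hn <;> linarith

lemma exists_sewing_radius (C A K : ℝ) {ρ : ℝ} (hρ : 0 < ρ) :
    ∃ δ > 0, δ ≤ 1 ∧ C * (A * δ) ≤ 1 ∧ 7 * (A * δ) < ρ ∧ K * δ ≤ 1 := by
  have hsmall (k : ℝ) {η : ℝ} (hη : 0 < η) : ∀ᶠ δ in 𝓝[>] (0 : ℝ), k * δ < η :=
    ((continuous_const_mul k).tendsto' 0 0 (mul_zero k)).mono_left nhdsWithin_le_nhds
      |>.eventually_lt_const hη
  obtain ⟨δ, hδ, hδ1, hC, hρδ, hK⟩ := (eventually_mem_nhdsWithin.and ((hsmall 1 one_pos).and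
    ((hsmall (C * A) one_pos).and ((hsmall (7 * A) hρ).and (hsmall K one_pos))))).exists
  exact ⟨δ, hδ, by linarith, by linarith, by linarith, hK.le⟩

namespace IsLocalLogarithm

variable {L : G → E} {V : Set G} {C ρ A p s t : ℝ} {γ : ℝ → G} {x : ℝ → E} {Ω : ℝ → ℝ → ℝ}

lemma mem_and_norm_sub_le_of_isTangentOn (hL : IsLocalLogarithm L V C ρ) {δ ε : ℝ} (hA : 0 ≤ A)
    (hp : 1 / 2 < p) (hCδ : C * (A * δ) ≤ 1) (hρδ : 7 * (A * δ) < ρ) (hst : s ≤ t)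
    (hT : IsTangentOn L V γ x s t) (hΩ : IsControlOn Ω (Icc s t)) (hΩδ : Ω s t ^ p ≤ δ)
    (hε : 0 < ε)
    (hsmall : ∀ u ∈ Icc s t, ∀ w ∈ Icc s t, u ≤ w → (γ u)⁻¹ * γ w ∈ V →
      ‖L ((γ u)⁻¹ * γ w) - (x w - x u)‖ ≤ sewingConst p A C * (Ω u w ^ p) ^ 2 + ε * (w - u) →
      ‖L ((γ u)⁻¹ * γ w)‖ ≤ A * Ω u w ^ p) :
    (γ s)⁻¹ * γ t ∈ V ∧ ‖L ((γ s)⁻¹ * γ t) - (x t - x s)‖ ≤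
      sewingConst p A C * (Ω s t ^ p) ^ 2 + ε * (t - s) := by
  obtain ⟨h, hh, hstep⟩ := hT ε hε
  obtain ⟨n, hn⟩ := Icc.addNSMul_eq_right hst hh
  have hmono := Icc.monotone_addNSMul hst hh.le
  have hmem (i : ℕ) : (Icc.addNSMul hst h i : ℝ) ∈ Icc s t := (Icc.addNSMul hst h i).2
  have hsewn := hL.sewing hA hp hCδ hρδ (g := fun i ↦ γ (Icc.addNSMul hst h i))
    (x := fun i ↦ x (Icc.addNSMul hst h i)) (e := fun i ↦ ε * Icc.addNSMul hst h i)
    (hΩ.comp_monotone (f := fun i ↦ (Icc.addNSMul hst h i : ℝ)) (fun i j hij ↦ hmono hij) hmem)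
    (fun i j hij ↦ (Real.rpow_le_rpow (hΩ.nonneg (hmem i) (hmem j) (hmono hij))
      (hΩ.mono (left_mem_Icc.2 hst) (hmem i) (hmem j) (right_mem_Icc.2 hst) (hmem i).1 (hmono hij)
        (hmem j).2) (by linarith)).trans hΩδ)
    (fun i j hij hV hle ↦ hsmall _ (hmem i) _ (hmem j) (hmono hij) hV (by rwa [mul_sub]))
    (fun i ↦ by
      rw [← mul_sub]
      exact hstep (hmem i).1 (hmono i.le_succ) (hmem _).2 ((le_abs_self _).trans
        (Icc.abs_sub_addNSMul_le hst hh.le i ⟨hmono i.le_succ, le_rfl⟩))) n 0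
  simpa only [zero_add, Icc.addNSMul_zero, hn n le_rfl, ← mul_sub] using hsewn

/-- Since `x` is only tangent to `γ`, the increments of `x` and `γ` are compared on the intervals
of the sewing induction through the control `Ω u w + ε * (w - u)`, and `ε` tends to zero. -/
theorem exists_mem_and_norm_sub_le (hL : IsLocalLogarithm L V C ρ) (hρ : 0 < ρ) (hA : 0 ≤ A)
    (hp : 1 / 2 < p) (hp1 : p ≤ 1) :
    ∃ δ > 0, ∃ K ≥ 0, ∀ ⦃γ : ℝ → G⦄ ⦃x : ℝ → E⦄ ⦃Ω : ℝ → ℝ → ℝ⦄ ⦃s t : ℝ⦄, s ≤ t →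
      IsTangentOn L V γ x s t → IsControlOn Ω (Icc s t) →
      (∀ u ∈ Icc s t, ∀ w ∈ Icc s t, u ≤ w → (γ u)⁻¹ * γ w ∈ V →
        min ‖L ((γ u)⁻¹ * γ w)‖ ‖x w - x u‖ ≤ A * Ω u w ^ p) →
      Ω s t ^ p < δ →
      (γ s)⁻¹ * γ t ∈ V ∧ ‖L ((γ s)⁻¹ * γ t) - (x t - x s)‖ ≤ K * (Ω s t ^ p) ^ 2 := by
  set K := sewingConst p (A + 2) C
  have hK : 0 ≤ K := sewingConst_nonneg hp hL.nonneg
  obtain ⟨δ, hδ, hδ1, hCδ, hρδ, hKδ⟩ := exists_sewing_radius C (A + 2) K hρ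
  refine ⟨δ, hδ, K, hK, fun γ x Ω s t hst hT hΩ hmin hΩδ ↦ ?_⟩
  have hlim : Tendsto (fun ε ↦ (Ω s t + ε * (t - s)) ^ p) (𝓝[>] 0) (𝓝 (Ω s t ^ p)) := by
    refine (Continuous.tendsto' ?_ 0 _ (by simp)).mono_left nhdsWithin_le_nhds
    exact (Real.continuous_rpow_const (by linarith)).comp (by fun_prop)
  have hsewn : ∀ᶠ ε in 𝓝[>] (0 : ℝ), (γ s)⁻¹ * γ t ∈ V ∧ ‖L ((γ s)⁻¹ * γ t) - (x t - x s)‖ ≤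
      K * ((Ω s t + ε * (t - s)) ^ p) ^ 2 + ε * (t - s) := by
    filter_upwards [self_mem_nhdsWithin, hlim.eventually_lt_const hΩδ] with ε hε hεδ
    have hQ := hΩ.add (IsControlOn.const_mul_sub (le_of_lt hε) (Icc s t))
    refine hL.mem_and_norm_sub_le_of_isTangentOn (by positivity) hp hCδ hρδ hst hT hQ hεδ.le hε
      fun u hu w hw huw hV hle ↦ ?_
    have hQδ : (Ω u w + ε * (w - u)) ^ p ≤ δ :=
      (Real.rpow_le_rpow (hQ.nonneg hu hw huw) (hQ.mono (left_mem_Icc.2 hst) hu hw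
        (right_mem_Icc.2 hst) hu.1 huw hw.2) (by linarith)).trans hεδ.le
    exact le_add_two_mul_rpow_of_min_le hA (by linarith) hp1 (hΩ.nonneg hu hw huw)
      (mul_nonneg (le_of_lt hε) (sub_nonneg.2 huw)) rfl (hQδ.trans hδ1)
      ((mul_le_mul_of_nonneg_left hQδ hK).trans hKδ) (hmin u hu w hw huw hV)
      (by linarith [norm_le_insert' (L ((γ u)⁻¹ * γ w)) (x w - x u)])
  obtain ⟨_, hmem, -⟩ := hsewn.exists
  refine ⟨hmem, ge_of_tendsto ?_ (hsewn.mono fun ε h ↦ h.2)⟩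
  have herr : Tendsto (fun ε ↦ ε * (t - s)) (𝓝[>] 0) (𝓝 0) :=
    ((continuous_mul_const (t - s)).tendsto' 0 0 (zero_mul _)).mono_left nhdsWithin_le_nhds
  simpa only [add_zero] using ((hlim.pow 2).const_mul K).add herr

end IsLocalLogarithm

end Tangency

section Calculus

variable {E F W : Type*} [NormedAddCommGroup E] [NormedSpace ℝ E]
  [NormedAddCommGroup F] [NormedSpace ℝ F] [NormedAddCommGroup W] [NormedSpace ℝ W]

lemma hasFDerivAt_comp_prodMk_right {f : E × F → W} {y : E} {z : F}
    (hf : DifferentiableAt ℝ f (y, z)) :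
    HasFDerivAt (fun z ↦ f (y, z)) ((fderiv ℝ f (y, z)).comp (.inr ℝ E F)) z :=
  hf.hasFDerivAt.comp z (hasFDerivAt_prodMk_right y z)

lemma exists_lipschitzOnWith_fderiv_comp_inr {f : E × F → W} {p₀ : E × F}
    (hf : ContDiffAt ℝ 2 f p₀) :
    ∃ K, ∃ s ∈ 𝓝 p₀, (∀ p ∈ s, DifferentiableAt ℝ f p) ∧
      LipschitzOnWith K (fun p ↦ (fderiv ℝ f p).comp (.inr ℝ E F)) s := by
  obtain ⟨K, s, hs, hK⟩ := (hf.fderiv_right (m := 1) (by norm_num)).exists_lipschitzOnWith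
  have hd : ∀ᶠ p in 𝓝 p₀, DifferentiableAt ℝ f p :=
    (hf.eventually (by simp)).mono fun p hp ↦ hp.differentiableAt two_ne_zero
  refine ⟨K, _, inter_mem hs hd, fun p hp ↦ hp.2, .of_dist_le_mul fun p hp q hq ↦ ?_⟩
  rw [dist_eq_norm, ← ContinuousLinearMap.sub_comp]
  calc ‖(fderiv ℝ f p - fderiv ℝ f q).comp (.inr ℝ E F)‖
      ≤ ‖fderiv ℝ f p - fderiv ℝ f q‖ * ‖ContinuousLinearMap.inr ℝ E F‖ :=
        ContinuousLinearMap.opNorm_comp_le _ _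
    _ ≤ ‖fderiv ℝ f p - fderiv ℝ f q‖ :=
        mul_le_of_le_one_right (norm_nonneg _) (ContinuousLinearMap.norm_inr_le_one ℝ E F)
    _ ≤ K * dist p q := by simpa only [dist_eq_norm] using hK.norm_sub_le hp.1 hq.1

lemma exists_eventually_norm_mixed_difference_le {f : E × F → W} (hf : ContDiffAt ℝ 2 f 0) :
    ∃ C : ℝ, 0 ≤ C ∧ ∀ᶠ p in 𝓝 (0 : E × F),
      ‖(f p - f (0, p.2)) - (f (p.1, 0) - f 0)‖ ≤ C * ‖p.1‖ * ‖p.2‖ := by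
  obtain ⟨K, s, hs, hd, hK⟩ := exists_lipschitzOnWith_fderiv_comp_inr hf
  obtain ⟨ε, hε, hεs⟩ := Metric.mem_nhds_iff.1 hs
  refine ⟨K, K.2, ?_⟩
  filter_upwards [Metric.ball_mem_nhds (0 : E × F) hε] with ⟨y, z⟩ hyz
  have hmem : ∀ {y z}, y ∈ Metric.ball (0 : E) ε → z ∈ Metric.ball (0 : F) ε → (y, z) ∈ s :=
    fun hy hz ↦ hεs (by rw [← Prod.mk_zero_zero, ← ball_prod_same]; exact ⟨hy, hz⟩)
  obtain ⟨hy, hz⟩ : y ∈ Metric.ball (0 : E) ε ∧ z ∈ Metric.ball (0 : F) ε := by simpa using hyz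
  have hder : ∀ {y}, y ∈ Metric.ball (0 : E) ε → ∀ {z}, z ∈ Metric.ball (0 : F) ε →
      HasFDerivWithinAt (fun z ↦ f (y, z)) ((fderiv ℝ f (y, z)).comp (.inr ℝ E F))
        (Metric.ball (0 : F) ε) z := fun hy z hz ↦
    (hasFDerivAt_comp_prodMk_right (hd _ (hmem hy hz))).hasFDerivWithinAt
  simpa only [sub_zero, Pi.sub_apply, Prod.mk_zero_zero] using
    (convex_ball (0 : F) ε).norm_image_sub_le_of_norm_hasFDerivWithin_le
      (fun z hz ↦ (hder hy hz).sub (hder (Metric.mem_ball_self hε) hz))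
      (fun z hz ↦ by simpa [Prod.norm_def] using
        hK.norm_sub_le (hmem hy hz) (hmem (Metric.mem_ball_self hε) hz))
      (Metric.mem_ball_self hε) hz

lemma exists_eventually_norm_fderiv_comp_inr_sub_id_le {f : E × F → F} (hf : ContDiffAt ℝ 2 f 0)
    (hf₀ : ∀ᶠ z in 𝓝 (0 : F), f (0, z) = z) :
    ∃ C : ℝ, ∀ᶠ p in 𝓝 (0 : E × F), DifferentiableAt ℝ f p ∧
      ‖(fderiv ℝ f p).comp (.inr ℝ E F) - .id ℝ F‖ ≤ C * ‖p‖ := by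
  obtain ⟨K, s, hs, hd, hK⟩ := exists_lipschitzOnWith_fderiv_comp_inr hf
  have h0 : (0 : E × F) ∈ s := mem_of_mem_nhds hs
  have hid : (fderiv ℝ f 0).comp (.inr ℝ E F) = .id ℝ F :=
    (hasFDerivAt_comp_prodMk_right (hd 0 h0)).unique
      ((hasFDerivAt_id (0 : F)).congr_of_eventuallyEq hf₀)
  exact ⟨K, Filter.mem_of_superset hs fun p hp ↦
    ⟨hd p hp, by simpa only [hid, sub_zero] using hK.norm_sub_le hp h0⟩⟩

end Calculus

section Chart

variable {E : Type*} [NormedAddCommGroup E] [NormedSpace ℝ E]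
  {H : Type*} [TopologicalSpace H] (I : ModelWithCorners ℝ E H)
  {G : Type*} [TopologicalSpace G] [ChartedSpace H G] [Group G]

/-- The coordinates of the preferred chart at the identity, centered at `0`. -/
def chartLog (g : G) : E := extChartAt I (1 : G) g - extChartAt I (1 : G) 1

variable (G) in
/-- The inverse of the chart `chartLog`. -/
def chartExp (y : E) : G := (extChartAt I (1 : G)).symm (y + extChartAt I (1 : G) 1)

variable (G) in
/-- The coordinate ball of radius `ρ` around the identity. -/
def chartBall (ρ : ℝ) : Set G := {g | g ∈ (extChartAt I (1 : G)).source ∧ ‖chartLog I g‖ < ρ}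

variable {I} in
lemma chartBall_mono {ρ σ : ℝ} (h : σ ≤ ρ) : chartBall I G σ ⊆ chartBall I G ρ :=
  fun _ hg ↦ ⟨hg.1, hg.2.trans_le h⟩

@[simp] lemma chartLog_one : chartLog I (1 : G) = 0 := by simp [chartLog]

@[simp] lemma chartExp_zero : chartExp I G 0 = 1 := by simp [chartExp]

variable {I} in
lemma chartExp_chartLog {g : G} (hg : g ∈ (extChartAt I (1 : G)).source) :
    chartExp I G (chartLog I g) = g := by
  rw [chartExp, chartLog, sub_add_cancel, (extChartAt I (1 : G)).left_inv hg]

variable {I} in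
lemma chartLog_chartExp {y : E}
    (hy : y + extChartAt I (1 : G) 1 ∈ (extChartAt I (1 : G)).target) :
    chartLog I (chartExp I G y) = y := by
  rw [chartLog, chartExp, (extChartAt I (1 : G)).right_inv hy, add_sub_cancel_right]

lemma one_mem_chartBall {ρ : ℝ} (hρ : 0 < ρ) : (1 : G) ∈ chartBall I G ρ := by
  simp [chartBall, hρ]

lemma isOpen_chartBall (ρ : ℝ) : IsOpen (chartBall I G ρ) := by
  have hball : chartBall I G ρ =
      (extChartAt I (1 : G)).source ∩ chartLog I ⁻¹' Metric.ball 0 ρ := by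
    ext; simp [chartBall]
  rw [hball]
  exact ((continuousOn_extChartAt 1).sub continuousOn_const).isOpen_inter_preimage
    (isOpen_extChartAt_source _) Metric.isOpen_ball

variable (G) in
lemma eventually_add_mem_target [I.Boundaryless] :
    ∀ᶠ y in 𝓝 (0 : E), y + extChartAt I (1 : G) 1 ∈ (extChartAt I (1 : G)).target := by
  have h : Tendsto (fun y : E ↦ y + extChartAt I (1 : G) 1) (𝓝 0)
      (𝓝 (extChartAt I (1 : G) 1)) :=
    Continuous.tendsto' (by fun_prop) _ _ (zero_add _)
  exact h (extChartAt_target_mem_nhds (1 : G))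

lemma contMDiffAt_chartLog {n : ℕ∞ω} [IsManifold I n G] {g : G}
    (hg : g ∈ (extChartAt I (1 : G)).source) : ContMDiffAt I 𝓘(ℝ, E) n (chartLog I) g :=
  (contMDiffAt_extChartAt' (by simpa using hg)).sub contMDiffAt_const

variable {I} in
lemma contMDiffAt_chartExp [I.Boundaryless] {n : ℕ∞ω} [IsManifold I n G] {y : E}
    (hy : y + extChartAt I (1 : G) 1 ∈ (extChartAt I (1 : G)).target) :
    ContMDiffAt 𝓘(ℝ, E) I n (chartExp I G) y :=
  ContMDiffAt.comp y
    ((contMDiffOn_extChartAt_symm (1 : G)).contMDiffAt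
      ((isOpen_extChartAt_target (1 : G)).mem_nhds hy))
    (contDiff_id.add contDiff_const).contMDiff.contMDiffAt

end Chart

section Velocity

variable {E : Type*} [NormedAddCommGroup E] [NormedSpace ℝ E]
  {H : Type*} [TopologicalSpace H] {I : ModelWithCorners ℝ E H}
  {G : Type*} [TopologicalSpace G] [ChartedSpace H G] [Group G] [LieGroup I 1 G]
  {a b : ℝ} {c : ℝ → G}

lemma hasDerivWithinAt_chartLog_inv_mul {t : ℝ}
    (hc : MDifferentiableWithinAt 𝓘(ℝ, ℝ) I c (Icc a b) t) :
    HasDerivWithinAt (fun t' ↦ chartLog I ((c t)⁻¹ * c t')) (leftVelocity I a b c t)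
      (Icc a b) t := by
  let D : ℝ →L[ℝ] E := (mfderiv I I (fun h : G ↦ (c t)⁻¹ * h) (c t)).comp
    (mfderivWithin 𝓘(ℝ, ℝ) I c (Icc a b) t)
  have hD := (mdifferentiableAt_mul_left.hasMFDerivAt.comp_hasMFDerivWithinAt t
    hc.hasMFDerivWithinAt : HasMFDerivWithinAt 𝓘(ℝ, ℝ) I (fun t' ↦ (c t)⁻¹ * c t') _ t D).2
  simp only [writtenInExtChartAt, Function.comp_apply, inv_mul_cancel,
    extChartAt_model_space_eq_id] at hD
  have hset : (PartialEquiv.refl ℝ).symm ⁻¹' Icc a b ∩ range 𝓘(ℝ, ℝ) = Icc a b := by simp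
  rw [hset] at hD
  have hchart : HasFDerivWithinAt (fun t' ↦ extChartAt I (1 : G) ((c t)⁻¹ * c t')) D
      (Icc a b) t := hD
  exact hchart.hasDerivWithinAt.sub_const (extChartAt I (1 : G) 1)

lemma leftVelocity_eq_derivWithin {t : ℝ} (hab : a < b) (ht : t ∈ Icc a b)
    (hc : MDifferentiableWithinAt 𝓘(ℝ, ℝ) I c (Icc a b) t) :
    leftVelocity I a b c t = derivWithin (fun t' ↦ chartLog I ((c t)⁻¹ * c t')) (Icc a b) t :=
  ((hasDerivWithinAt_chartLog_inv_mul hc).derivWithin (uniqueDiffOn_Icc hab t ht)).symm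

lemma leftVelocity_const_mul {t : ℝ} (hab : a < b) (ht : t ∈ Icc a b) (g : G)
    (hc : MDifferentiableWithinAt 𝓘(ℝ, ℝ) I c (Icc a b) t) :
    leftVelocity I a b (fun t ↦ g * c t) t = leftVelocity I a b c t := by
  have hgc : MDifferentiableWithinAt 𝓘(ℝ, ℝ) I (fun t ↦ g * c t) (Icc a b) t :=
    mdifferentiableAt_mul_left.comp_mdifferentiableWithinAt t hc
  rw [leftVelocity_eq_derivWithin hab ht hgc, leftVelocity_eq_derivWithin hab ht hc]
  simp only [mul_inv_rev, mul_assoc, inv_mul_cancel_left]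
  rfl

lemma leftVelocity_subinterval {s t τ : ℝ} (has : a ≤ s) (hst : s < t) (htb : t ≤ b)
    (hτ : τ ∈ Icc s t) (hc : MDifferentiableWithinAt 𝓘(ℝ, ℝ) I c (Icc a b) τ) :
    leftVelocity I s t c τ = leftVelocity I a b c τ := by
  have hsub := Icc_subset_Icc has htb
  rw [leftVelocity_eq_derivWithin hst hτ (hc.mono hsub)]
  exact ((hasDerivWithinAt_chartLog_inv_mul hc).mono hsub).derivWithin
    (uniqueDiffOn_Icc hst τ hτ)

lemma contDiffWithinAt_chartLog_comp {s : Set ℝ} {t : ℝ}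
    (hc : ContMDiffWithinAt 𝓘(ℝ, ℝ) I 1 c s t) (ht : c t ∈ (extChartAt I (1 : G)).source) :
    ContDiffWithinAt ℝ 1 (fun t ↦ chartLog I (c t)) s t :=
  contMDiffWithinAt_iff_contDiffWithinAt.1
    (ContMDiffAt.comp_contMDiffWithinAt t (contMDiffAt_chartLog I ht) hc)

lemma differentiableWithinAt_chartLog_comp {s : Set ℝ} {t : ℝ}
    (hc : MDifferentiableWithinAt 𝓘(ℝ, ℝ) I c s t)
    (ht : c t ∈ (extChartAt I (1 : G)).source) :
    DifferentiableWithinAt ℝ (fun t ↦ chartLog I (c t)) s t :=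
  mdifferentiableWithinAt_iff_differentiableWithinAt.1
    (((contMDiffAt_chartLog I ht).mdifferentiableAt one_ne_zero).comp_mdifferentiableWithinAt
      t hc)

end Velocity

section ChartBounds

variable {E : Type*} [NormedAddCommGroup E] [NormedSpace ℝ E]
  {H : Type*} [TopologicalSpace H] (I : ModelWithCorners ℝ E H)
  (G : Type*) [TopologicalSpace G] [ChartedSpace H G] [Group G]

/-- The product `(y, z) ↦ y * z` of `G` in the coordinates `chartLog`. -/
def chartMul (p : E × E) : E := chartLog I (chartExp I G p.1 * chartExp I G p.2)

/-- The left division `(y, z) ↦ y⁻¹ * z` of `G` in the coordinates `chartLog`. -/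
def chartDivision (p : E × E) : E := chartLog I ((chartExp I G p.1)⁻¹ * chartExp I G p.2)

/-- The left Maurer–Cartan form of `G` in the coordinates `chartLog`: the operator which takes the
coordinate velocity of a curve through the point with coordinates `y` to its left-invariant
velocity. -/
def chartMaurerCartan (y : E) : E →L[ℝ] E :=
  (fderiv ℝ (chartDivision I G) (y, y)).comp (.inr ℝ E E)

section ContMDiff

variable [I.Boundaryless] {n : ℕ∞ω}

lemma contMDiffAt_chartExp_fst [IsManifold I n G] :
    ContMDiffAt 𝓘(ℝ, E × E) I n (fun p : E × E ↦ chartExp I G p.1) 0 :=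
  ContMDiffAt.comp (g := chartExp I G) (f := Prod.fst) (0 : E × E)
    (contMDiffAt_chartExp (eventually_add_mem_target I G).self_of_nhds)
    contDiff_fst.contMDiff.contMDiffAt

lemma contMDiffAt_chartExp_snd [IsManifold I n G] :
    ContMDiffAt 𝓘(ℝ, E × E) I n (fun p : E × E ↦ chartExp I G p.2) 0 :=
  ContMDiffAt.comp (g := chartExp I G) (f := Prod.snd) (0 : E × E)
    (contMDiffAt_chartExp (eventually_add_mem_target I G).self_of_nhds)
    contDiff_snd.contMDiff.contMDiffAt

lemma contDiffAt_chartMul [ContMDiffMul I n G] : ContDiffAt ℝ n (chartMul I G) 0 :=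
  contMDiffAt_iff_contDiffAt.1 <| ContMDiffAt.comp (g := chartLog I)
    (f := fun p : E × E ↦ chartExp I G p.1 * chartExp I G p.2) (0 : E × E)
    (contMDiffAt_chartLog I (by simp))
    ((contMDiffAt_chartExp_fst I G).mul (contMDiffAt_chartExp_snd I G))

lemma contDiffAt_chartDivision [LieGroup I n G] : ContDiffAt ℝ n (chartDivision I G) 0 :=
  contMDiffAt_iff_contDiffAt.1 <| ContMDiffAt.comp (g := chartLog I)
    (f := fun p : E × E ↦ (chartExp I G p.1)⁻¹ * chartExp I G p.2) (0 : E × E)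
    (contMDiffAt_chartLog I (by simp))
    ((contMDiffAt_chartExp_fst I G).inv.mul (contMDiffAt_chartExp_snd I G))

lemma eventually_chartExp_mul_mem_source [ContMDiffMul I 1 G] :
    ∀ᶠ p in 𝓝 (0 : E × E), chartExp I G p.1 * chartExp I G p.2 ∈ (extChartAt I (1 : G)).source :=
  ((contMDiffAt_chartExp_fst I G (n := 1)).mul
    (contMDiffAt_chartExp_snd I G)).continuousAt.eventually_mem
      (by simpa using extChartAt_source_mem_nhds (I := I) (1 : G))

end ContMDiff

/-- Uniform estimates on the coordinate ball of radius `ρ` around the identity: the group is there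
approximately its Lie algebra, with errors of second order controlled by `C`. -/
structure ChartBounds (ρ C : ℝ) : Prop
    extends IsLocalLogarithm (chartLog I) (chartBall I G ρ) C ρ where
  pos : 0 < ρ
  mul_le_half : C * ρ ≤ 1 / 2
  mem_target : ∀ ⦃y : E⦄, ‖y‖ < ρ → y + extChartAt I (1 : G) 1 ∈ (extChartAt I (1 : G)).target
  differentiableAt : ∀ ⦃y⦄, ‖y‖ < ρ → DifferentiableAt ℝ (chartDivision I G) (y, y)
  norm_maurerCartan_sub_id_le : ∀ ⦃y⦄, ‖y‖ < ρ → ‖chartMaurerCartan I G y - .id ℝ E‖ ≤ C * ‖y‖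

lemma exists_norm_chartMul_sub_sub_le [I.Boundaryless] [ContMDiffMul I 2 G] :
    ∃ C : ℝ, 0 ≤ C ∧ ∀ᶠ p in 𝓝 (0 : E × E),
      ‖chartMul I G p - p.1 - p.2‖ ≤ C * ‖p.1‖ * ‖p.2‖ := by
  obtain ⟨C, hC, h⟩ := exists_eventually_norm_mixed_difference_le (contDiffAt_chartMul I G (n := 2))
  have htgt := eventually_add_mem_target I G
  refine ⟨C, hC, ?_⟩
  filter_upwards [h, (continuous_fst.tendsto' (0 : E × E) 0 rfl).eventually htgt,
    (continuous_snd.tendsto' (0 : E × E) 0 rfl).eventually htgt] with p hp h₁ h₂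
  convert hp using 2
  simp [chartMul, chartLog_chartExp h₁, chartLog_chartExp h₂, sub_right_comm]

lemma exists_norm_chartMaurerCartan_sub_id_le [I.Boundaryless] [LieGroup I 2 G] :
    ∃ C : ℝ, ∀ᶠ y in 𝓝 (0 : E), DifferentiableAt ℝ (chartDivision I G) (y, y) ∧
      ‖chartMaurerCartan I G y - .id ℝ E‖ ≤ C * ‖y‖ := by
  obtain ⟨C, h⟩ := exists_eventually_norm_fderiv_comp_inr_sub_id_le
    (contDiffAt_chartDivision I G (n := 2))
    ((eventually_add_mem_target I G).mono fun y hy ↦ by simp [chartDivision, chartLog_chartExp hy])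
  have hdiag : Tendsto (fun y : E ↦ (y, y)) (𝓝 0) (𝓝 0) :=
    Continuous.tendsto' (by fun_prop) _ _ rfl
  exact ⟨C, (hdiag.eventually h).mono fun y hy ↦ by simpa [chartMaurerCartan] using hy⟩

lemma exists_chartBall_mul_bounds [I.Boundaryless] [LieGroup I 2 G] :
    ∃ C : ℝ, 0 ≤ C ∧ ∃ ε > 0, ∀ ⦃g⦄, g ∈ chartBall I G ε → ∀ ⦃h⦄, h ∈ chartBall I G ε →
      ‖chartLog I (g * h) - chartLog I g - chartLog I h‖ ≤ C * ‖chartLog I g‖ * ‖chartLog I h‖ ∧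
        g * h ∈ (extChartAt I (1 : G)).source := by
  obtain ⟨C, hC, hmul⟩ := exists_norm_chartMul_sub_sub_le I G
  obtain ⟨ε, hε, hball⟩ := Metric.eventually_nhds_iff.1
    (hmul.and (eventually_chartExp_mul_mem_source I G))
  refine ⟨C, hC, ε, hε, fun g hg h hh ↦ ?_⟩
  simpa only [chartMul, chartExp_chartLog hg.1, chartExp_chartLog hh.1] using
    hball (y := (chartLog I g, chartLog I h)) (by simpa using ⟨hg.2, hh.2⟩)

theorem exists_chartBounds [I.Boundaryless] [LieGroup I 2 G] : ∃ ρ C, ChartBounds I G ρ C := by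
  obtain ⟨C₁, hC₁, ε₁, hε₁, hmul⟩ := exists_chartBall_mul_bounds I G
  obtain ⟨C₂, hdiv⟩ := exists_norm_chartMaurerCartan_sub_id_le I G
  obtain ⟨ε₂, hε₂, hdiv⟩ := Metric.eventually_nhds_iff.1
    (hdiv.and (eventually_add_mem_target I G))
  set C := max C₁ C₂
  set ρ := min (min ε₁ ε₂) (1 / (2 * (C + 1)))
  have hC : 0 ≤ C := hC₁.trans (le_max_left _ _)
  have hρ₂ : ρ ≤ ε₂ := (min_le_left _ _).trans (min_le_right _ _)
  have hsub : chartBall I G ρ ⊆ chartBall I G ε₁ :=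
    chartBall_mono ((min_le_left _ _).trans (min_le_left _ _))
  have hball : ∀ ⦃y : E⦄, ‖y‖ < ρ → dist y 0 < ε₂ := fun y hy ↦ by simpa using hy.trans_le hρ₂
  have hρ : 0 < ρ := by positivity
  exact ⟨ρ, C,
    { nonneg := hC
      one_mem := one_mem_chartBall I hρ
      map_one := chartLog_one I
      norm_map_mul_sub_le := fun g hg h hh ↦ (hmul (hsub hg) (hsub hh)).1.trans (by
        gcongr; exact le_max_left _ _)
      mul_mem := fun g hg h hh hgh ↦ ⟨(hmul (hsub hg) (hsub hh)).2, hgh⟩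
      pos := hρ
      mul_le_half := by
        calc C * ρ ≤ C * (1 / (2 * (C + 1))) := by gcongr; exact min_le_right _ _
          _ ≤ 1 / 2 := by
            rw [mul_one_div, div_le_div_iff₀ (by positivity) two_pos]
            linarith
      mem_target := fun y hy ↦ (hdiv (hball hy)).2
      differentiableAt := fun y hy ↦ (hdiv (hball hy)).1.1
      norm_maurerCartan_sub_id_le := fun y hy ↦ (hdiv (hball hy)).1.2.trans (by
        gcongr; exact le_max_right _ _) }⟩

variable {I G}

lemma leftVelocity_eq_chartMaurerCartan [LieGroup I 1 G] {a b t : ℝ} {c : ℝ → G} (hab : a < b)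
    (ht : t ∈ Icc a b) (hc : MDifferentiableWithinAt 𝓘(ℝ, ℝ) I c (Icc a b) t)
    (hct : c t ∈ (extChartAt I (1 : G)).source)
    (hd : DifferentiableAt ℝ (chartDivision I G) (chartLog I (c t), chartLog I (c t))) :
    leftVelocity I a b c t = chartMaurerCartan I G (chartLog I (c t))
      (derivWithin (fun t ↦ chartLog I (c t)) (Icc a b) t) := by
  have hsource : ∀ᶠ t' in 𝓝[Icc a b] t, c t' ∈ (extChartAt I (1 : G)).source :=
    hc.continuousWithinAt.eventually_mem ((isOpen_extChartAt_source (1 : G)).mem_nhds hct)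
  have hcurve := (differentiableWithinAt_chartLog_comp hc hct).hasDerivWithinAt
  have hdiv : HasDerivWithinAt (fun t' ↦ chartDivision I G (chartLog I (c t), chartLog I (c t')))
      (chartMaurerCartan I G (chartLog I (c t))
        (derivWithin (fun t ↦ chartLog I (c t)) (Icc a b) t)) (Icc a b) t :=
    (hasFDerivAt_comp_prodMk_right hd).comp_hasDerivWithinAt
      (f := fun t ↦ chartLog I (c t)) t hcurve
  have hcongr : ∀ᶠ t' in 𝓝[Icc a b] t, chartLog I ((c t)⁻¹ * c t') =
      chartDivision I G (chartLog I (c t), chartLog I (c t')) :=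
    hsource.mono fun t' ht' ↦ by
      simp only [chartDivision, chartExp_chartLog hct, chartExp_chartLog ht']
  rw [leftVelocity_eq_derivWithin hab ht hc]
  exact (hdiv.congr_of_eventuallyEq hcongr (hcongr.self_of_nhdsWithin ht)).derivWithin
    (uniqueDiffOn_Icc hab t ht)

end ChartBounds

section Distance

variable {E : Type*} [NormedAddCommGroup E] [NormedSpace ℝ E]
  {H : Type*} [TopologicalSpace H] (I : ModelWithCorners ℝ E H)
  {G : Type*} [TopologicalSpace G] [ChartedSpace H G] [Group G]
  (N : Seminorm ℝ (GroupLieAlgebra I G)) {a b : ℝ} {c : ℝ → G} {g h : G}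

lemma enormSMulClass_leftInvariantENorm (g : G) :
    letI := leftInvariantENorm I N
    ENormSMulClass ℝ (TangentSpace I g) := by
  let := leftInvariantENorm I N
  refine ⟨fun k x ↦ ?_⟩
  change ENNReal.ofReal (N (toLieAlgebra I g (k • x))) =
    ‖k‖ₑ * ENNReal.ofReal (N (toLieAlgebra I g x))
  have hsmul : toLieAlgebra I g (k • x) = k • toLieAlgebra I g x :=
    (mfderiv I I (fun h : G ↦ g⁻¹ * h) g).map_smul k x
  rw [hsmul, map_smul_eq_mul, ENNReal.ofReal_mul (norm_nonneg _), ofReal_norm]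

lemma leftInvariantEDist_le_lintegral (hab : a ≤ b) (hc : ContMDiffOn 𝓘(ℝ, ℝ) I 1 c (Icc a b)) :
    leftInvariantEDist I N (c a) (c b) ≤
      ∫⁻ t in Icc a b, ENNReal.ofReal (N (leftVelocity I a b c t)) := by
  let := leftInvariantENorm I N
  have := enormSMulClass_leftInvariantENorm I N
  exact (Manifold.riemannianEDist_le_pathELength hc rfl rfl hab).trans_eq
    Manifold.pathELength_eq_lintegral_mfderivWithin_Icc

lemma exists_lintegral_lt_of_leftInvariantEDist_lt {R : ℝ≥0∞}
    (hR : leftInvariantEDist I N g h < R) :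
    ∃ c : ℝ → G, c 0 = g ∧ c 1 = h ∧ ContMDiffOn 𝓘(ℝ, ℝ) I 1 c (Icc 0 1) ∧
      ∫⁻ t in Icc 0 1, ENNReal.ofReal (N (leftVelocity I 0 1 c t)) < R := by
  let := leftInvariantENorm I N
  obtain ⟨c, h0, h1, hc, hlen⟩ := Manifold.exists_lt_of_riemannianEDist_lt hR
  rw [Manifold.pathELength_eq_lintegral_mfderivWithin_Icc] at hlen
  exact ⟨c, h0, h1, hc, hlen⟩

lemma leftInvariantEDist_self : leftInvariantEDist I N g g = 0 := by
  let := leftInvariantENorm I N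
  have := enormSMulClass_leftInvariantENorm I N
  exact Manifold.riemannianEDist_self

lemma leftInvariantEDist_comm : leftInvariantEDist I N g h = leftInvariantEDist I N h g := by
  let := leftInvariantENorm I N
  have := enormSMulClass_leftInvariantENorm I N
  exact Manifold.riemannianEDist_comm

lemma leftInvariantEDist_triangle (g h k : G) :
    leftInvariantEDist I N g k ≤ leftInvariantEDist I N g h + leftInvariantEDist I N h k := by
  let := leftInvariantENorm I N
  have := enormSMulClass_leftInvariantENorm I N
  exact Manifold.riemannianEDist_triangle

variable [LieGroup I 1 G]

lemma leftInvariantEDist_mul_le (k : G) :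
    leftInvariantEDist I N (k * g) (k * h) ≤ leftInvariantEDist I N g h := by
  refine le_of_forall_gt fun R hR ↦ ?_
  obtain ⟨c, rfl, rfl, hc, hlen⟩ := exists_lintegral_lt_of_leftInvariantEDist_lt I N hR
  refine (leftInvariantEDist_le_lintegral I N zero_le_one
    (contMDiff_mul_left.comp_contMDiffOn hc)).trans_lt (lt_of_eq_of_lt ?_ hlen)
  refine setLIntegral_congr_fun measurableSet_Icc fun t ht ↦ ?_
  exact congrArg (fun v ↦ ENNReal.ofReal (N v))
    (leftVelocity_const_mul zero_lt_one ht k (hc.mdifferentiableOn one_ne_zero t ht))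

lemma leftInvariantEDist_eq_inv_mul :
    leftInvariantEDist I N g h = leftInvariantEDist I N 1 (g⁻¹ * h) := by
  refine le_antisymm ?_ ?_
  · simpa using leftInvariantEDist_mul_le I N (g := 1) (h := g⁻¹ * h) g
  · simpa using leftInvariantEDist_mul_le I N (g := g) (h := h) g⁻¹

lemma leftInvariantEDist_eq_inv_mul' :
    leftInvariantEDist I N g h = leftInvariantEDist I N 1 (h⁻¹ * g) :=
  (leftInvariantEDist_comm I N).trans (leftInvariantEDist_eq_inv_mul I N)

end Distance

section Seminorm

variable {E : Type*}

/-- The distance defined by a seminorm. On the model space of a Lie group it is `lieAlgebraEDist`,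
without the passage through the tangent space at the identity. -/
def seminormEDist [AddCommGroup E] [Module ℝ E] (N : Seminorm ℝ E) (x y : E) : ℝ≥0∞ :=
  ENNReal.ofReal (N (x - y))

lemma seminormEDist_self [AddCommGroup E] [Module ℝ E] (N : Seminorm ℝ E) (x : E) :
    seminormEDist N x x = 0 := by
  simp [seminormEDist]

lemma seminormEDist_triangle [AddCommGroup E] [Module ℝ E] (N : Seminorm ℝ E) (x y z : E) :
    seminormEDist N x z ≤ seminormEDist N x y + seminormEDist N y z := by
  simp only [seminormEDist]
  rw [← ENNReal.ofReal_add (apply_nonneg N _) (apply_nonneg N _)]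
  refine ENNReal.ofReal_le_ofReal ?_
  simpa using map_add_le_add N (x - y) (y - z)

variable [NormedAddCommGroup E] [NormedSpace ℝ E]

/-- `N` is a norm on `E` equivalent to the given one, with the same constant `κ` in both
directions. -/
structure IsEquivalentNorm (N : Seminorm ℝ E) (κ : ℝ) : Prop where
  nonneg : 0 ≤ κ
  le_mul_norm : ∀ v, N v ≤ κ * ‖v‖
  norm_le_mul : ∀ v, ‖v‖ ≤ κ * N v

lemma IsEquivalentNorm.continuous {N : Seminorm ℝ E} {κ : ℝ} (hN : IsEquivalentNorm N κ) :
    Continuous N :=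
  Seminorm.continuous_of_le (q := κ.toNNReal • normSeminorm ℝ E)
    (continuous_norm.const_smul κ.toNNReal) fun v ↦ by
      simpa [NNReal.smul_def, hN.nonneg] using hN.le_mul_norm v

lemma exists_norm_le_mul_seminorm [FiniteDimensional ℝ E] (N : Seminorm ℝ E)
    (hN : ∀ v, N v = 0 → v = 0) : ∃ κ : ℝ, ∀ v, ‖v‖ ≤ κ * N v := by
  rcases subsingleton_or_nontrivial E with hE | hE
  · exact ⟨1, fun v ↦ by simp [Subsingleton.elim v 0]⟩
  obtain ⟨x, hx, hmin⟩ := (isCompact_sphere (0 : E) 1).exists_isMinOn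
    (NormedSpace.sphere_nonempty.2 zero_le_one) N.convexOn.locallyLipschitz.continuous.continuousOn
  have hNx : 0 < N x := (apply_nonneg N x).lt_of_ne' fun h ↦
    Metric.ne_of_mem_sphere hx one_ne_zero (hN x h)
  refine ⟨(N x)⁻¹, fun v ↦ ?_⟩
  rcases eq_or_ne v 0 with rfl | hv
  · simp
  have hv' : 0 < ‖v‖ := norm_pos_iff.2 hv
  have hle : N x ≤ N (‖v‖⁻¹ • v) := hmin (by simp [norm_smul, hv'.ne'])
  rw [map_smul_eq_mul, norm_inv, norm_norm, inv_mul_eq_div, le_div_iff₀ hv', mul_comm] at hle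
  rwa [inv_mul_eq_div, le_div_iff₀ hNx]

lemma exists_isEquivalentNorm [FiniteDimensional ℝ E] (N : Seminorm ℝ E)
    (hN : ∀ v, N v = 0 → v = 0) : ∃ κ, IsEquivalentNorm N κ := by
  obtain ⟨κ₁, hκ₁, h₁⟩ := Seminorm.bound_of_continuous_normedSpace N
    N.convexOn.locallyLipschitz.continuous
  obtain ⟨κ₂, h₂⟩ := exists_norm_le_mul_seminorm N hN
  refine ⟨max κ₁ κ₂, hκ₁.le.trans (le_max_left _ _), fun v ↦ (h₁ v).trans ?_,
    fun v ↦ (h₂ v).trans ?_⟩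
  · gcongr
    exact le_max_left _ _
  · gcongr
    exact le_max_right _ _

lemma seminorm_integral_le [CompleteSpace E] {N : Seminorm ℝ E} (hN : Continuous N) {α : Type*}
    [MeasurableSpace α] {μ : Measure α} [IsFiniteMeasure μ] {f : α → E} (hf : Integrable f μ)
    (hNf : Integrable (fun x ↦ N (f x)) μ) : N (∫ x, f x ∂μ) ≤ ∫ x, N (f x) ∂μ := by
  rcases eq_or_ne μ 0 with rfl | hμ
  · simp
  have : NeZero μ := ⟨hμ⟩
  have hμ' : 0 < μ.real univ := by simpa [measureReal_def, ENNReal.toReal_pos_iff] using hμ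
  have hJensen := N.convexOn.map_average_le hN.continuousOn isClosed_univ (by simp) hf hNf
  rw [average_eq, average_eq, map_smul_eq_mul, Real.norm_of_nonneg (by positivity), smul_eq_mul]
    at hJensen
  exact le_of_mul_le_mul_left hJensen (by positivity)

end Seminorm

lemma exists_inv_mul_mem_of_dist_le {X G : Type*} [PseudoMetricSpace X] [TopologicalSpace G]
    [Group G] [IsTopologicalGroup G] {K : Set X} (hK : IsCompact K) {c : X → G}
    (hc : ContinuousOn c K) {U : Set G} (hU : U ∈ 𝓝 1) :
    ∃ h > 0, ∀ s ∈ K, ∀ t ∈ K, dist s t ≤ h → (c s)⁻¹ * c t ∈ U := by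
  let := IsTopologicalGroup.leftUniformSpace G
  have huc := hK.uniformContinuousOn_of_continuous hc
  obtain ⟨h, hh, hsub⟩ := (Metric.uniformity_basis_dist_le.inf_principal _).mem_iff.1
    (huc (preimage_mem_comap (m := fun p : G × G ↦ p.1⁻¹ * p.2) hU))
  exact ⟨h, hh, fun s hs t ht hst ↦ hsub (a := (s, t)) ⟨hst, hs, ht⟩⟩

section Trace

variable {E : Type*} [NormedAddCommGroup E] [NormedSpace ℝ E]
  {H : Type*} [TopologicalSpace H] (I : ModelWithCorners ℝ E H)
  {G : Type*} [TopologicalSpace G] [ChartedSpace H G] [Group G]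

/-- The left velocity `leftVelocity`, as a vector of the model space `E`. -/
def modelVelocity (a b : ℝ) (γ : ℝ → G) (t : ℝ) : E := leftVelocity I a b γ t

/-- The left trace `leftTrace`, as a curve in the model space `E`. -/
def modelTrace (a b : ℝ) (γ : ℝ → G) (t : ℝ) : E := ∫ s in a..t, modelVelocity I a b γ s

variable {I} {a b : ℝ} {γ : ℝ → G}

lemma ChartBounds.norm_maurerCartan_apply_sub_le {ρ C : ℝ} (hB : ChartBounds I G ρ C) {y : E}
    (hy : ‖y‖ < ρ) (u : E) : ‖chartMaurerCartan I G y u - u‖ ≤ C * ‖y‖ * ‖u‖ :=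
  ContinuousLinearMap.le_of_opNorm_le _ (hB.norm_maurerCartan_sub_id_le hy) u

lemma ChartBounds.norm_sub_maurerCartan_apply_le {ρ C : ℝ} (hB : ChartBounds I G ρ C) {y : E}
    (hy : ‖y‖ < ρ) (u : E) :
    ‖u - chartMaurerCartan I G y u‖ ≤ 2 * C * ‖y‖ * ‖chartMaurerCartan I G y u‖ := by
  have hC := hB.nonneg
  have hclose := hB.norm_maurerCartan_apply_sub_le hy u
  have hhalf : C * ‖y‖ ≤ 1 / 2 := (mul_le_mul_of_nonneg_left hy.le hC).trans hB.mul_le_half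
  have hu : ‖u‖ ≤ 2 * ‖chartMaurerCartan I G y u‖ := by
    linarith [norm_le_insert (chartMaurerCartan I G y u) u,
      mul_le_mul_of_nonneg_right hhalf (norm_nonneg u)]
  calc ‖u - chartMaurerCartan I G y u‖ ≤ C * ‖y‖ * ‖u‖ := by rwa [norm_sub_rev]
    _ ≤ C * ‖y‖ * (2 * ‖chartMaurerCartan I G y u‖) := by gcongr
    _ = _ := by ring

lemma continuousAt_chartMaurerCartan_zero [I.Boundaryless] [LieGroup I 1 G] :
    ContinuousAt (chartMaurerCartan I G) 0 := by
  have hfderiv : ContinuousAt (fderiv ℝ (chartDivision I G)) (0, 0) :=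
    ((contDiffAt_chartDivision I G (n := 1)).fderiv_right (m := 0) (by simp)).continuousAt
  have hdiag : ContinuousAt (fun y : E ↦ fderiv ℝ (chartDivision I G) (y, y)) 0 :=
    ContinuousAt.comp (f := fun y : E ↦ (y, y)) hfderiv (by fun_prop)
  exact hdiag.clm_comp continuousAt_const

variable (I G) in
lemma eventually_differentiableAt_chartDivision [I.Boundaryless] [LieGroup I 1 G] :
    ∀ᶠ y in 𝓝 (0 : E), DifferentiableAt ℝ (chartDivision I G) (y, y) := by
  have hdiag : Tendsto (fun y : E ↦ (y, y)) (𝓝 0) (𝓝 0) :=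
    Continuous.tendsto' (by fun_prop) _ _ rfl
  exact hdiag.eventually (((contDiffAt_chartDivision I G (n := 1)).eventually (by simp)).mono
    fun p hp ↦ hp.differentiableAt one_ne_zero)

lemma continuousOn_modelVelocity [I.Boundaryless] [LieGroup I 1 G] (hab : a < b)
    (hγ : ContMDiffOn 𝓘(ℝ, ℝ) I 1 γ (Icc a b)) :
    ContinuousOn (modelVelocity I a b γ) (Icc a b) := by
  intro t ht
  let q : ℝ → G := fun τ ↦ (γ t)⁻¹ * γ τ
  have hq : ContMDiffOn 𝓘(ℝ, ℝ) I 1 q (Icc a b) := contMDiff_mul_left.comp_contMDiffOn hγ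
  have hqt : q t = 1 := inv_mul_cancel _
  have hsource : ∀ᶠ τ in 𝓝[Icc a b] t, q τ ∈ (extChartAt I (1 : G)).source :=
    (hq t ht).continuousWithinAt.eventually_mem (hqt ▸ extChartAt_source_mem_nhds (1 : G))
  have hlog := contDiffWithinAt_chartLog_comp (hq t ht) (by simp [hqt])
  have hlog0 : Tendsto (fun τ ↦ chartLog I (q τ)) (𝓝[Icc a b] t) (𝓝 0) := by
    simpa [ContinuousWithinAt, hqt] using hlog.continuousWithinAt
  have hderiv : ContinuousWithinAt (derivWithin (fun τ ↦ chartLog I (q τ)) (Icc a b))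
      (Icc a b) t :=
    (hlog.fderivWithin_right (m := 0) (uniqueDiffOn_Icc hab) (by simp)
      ht).continuousWithinAt.clm_apply continuousWithinAt_const
  have hMC : ContinuousWithinAt (fun τ ↦ chartMaurerCartan I G (chartLog I (q τ))) (Icc a b) t := by
    rw [ContinuousWithinAt, hqt, chartLog_one]
    exact continuousAt_chartMaurerCartan_zero.tendsto.comp hlog0
  have hvelocity : ∀ᶠ τ in 𝓝[Icc a b] t, modelVelocity I a b γ τ =
      chartMaurerCartan I G (chartLog I (q τ))
        (derivWithin (fun τ ↦ chartLog I (q τ)) (Icc a b) τ) := by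
    filter_upwards [hsource, hlog0.eventually (eventually_differentiableAt_chartDivision I G),
      self_mem_nhdsWithin] with τ hqτ hd hτ
    exact (leftVelocity_const_mul hab hτ _ (hγ.mdifferentiableOn one_ne_zero τ hτ)).symm.trans
      (leftVelocity_eq_chartMaurerCartan hab hτ (hq.mdifferentiableOn one_ne_zero τ hτ) hqτ hd)
  exact (hMC.clm_apply hderiv).congr_of_eventuallyEq hvelocity (hvelocity.self_of_nhdsWithin ht)

variable [I.Boundaryless] [LieGroup I 1 G]

lemma exists_norm_modelVelocity_le (hab : a < b) (hγ : ContMDiffOn 𝓘(ℝ, ℝ) I 1 γ (Icc a b)) :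
    ∃ M, 0 ≤ M ∧ ∀ t ∈ Icc a b, ‖modelVelocity I a b γ t‖ ≤ M := by
  obtain ⟨M, hM⟩ := isCompact_Icc.exists_bound_of_continuousOn (continuousOn_modelVelocity hab hγ)
  exact ⟨max M 0, le_max_right _ _, fun t ht ↦ (hM t ht).trans (le_max_left _ _)⟩

lemma intervalIntegrable_modelVelocity (hab : a < b) (hγ : ContMDiffOn 𝓘(ℝ, ℝ) I 1 γ (Icc a b))
    {s t : ℝ} (hs : s ∈ Icc a b) (ht : t ∈ Icc a b) :
    IntervalIntegrable (modelVelocity I a b γ) volume s t :=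
  ((continuousOn_modelVelocity hab hγ).mono (uIcc_subset_Icc hs ht)).intervalIntegrable

lemma modelTrace_sub (hab : a < b) (hγ : ContMDiffOn 𝓘(ℝ, ℝ) I 1 γ (Icc a b)) {s t : ℝ}
    (hs : s ∈ Icc a b) (ht : t ∈ Icc a b) :
    modelTrace I a b γ t - modelTrace I a b γ s = ∫ τ in s..t, modelVelocity I a b γ τ :=
  have ha : a ∈ Icc a b := left_mem_Icc.2 hab.le
  intervalIntegral.integral_interval_sub_left (intervalIntegrable_modelVelocity hab hγ ha ht)
    (intervalIntegrable_modelVelocity hab hγ ha hs)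

lemma hasDerivWithinAt_modelTrace [CompleteSpace E] (hab : a < b)
    (hγ : ContMDiffOn 𝓘(ℝ, ℝ) I 1 γ (Icc a b)) {t : ℝ} (ht : t ∈ Icc a b) :
    HasDerivWithinAt (modelTrace I a b γ) (modelVelocity I a b γ t) (Icc a b) t := by
  have : Fact (t ∈ Icc a b) := ⟨ht⟩
  have hcont := continuousOn_modelVelocity hab hγ
  exact intervalIntegral.integral_hasDerivWithinAt_right
    (intervalIntegrable_modelVelocity hab hγ (left_mem_Icc.2 hab.le) ht)
    (hcont.stronglyMeasurableAtFilter_nhdsWithin measurableSet_Icc t) (hcont t ht)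

end Trace

lemma isControlOn_intervalIntegral {f : ℝ → ℝ} {a b : ℝ} (hf : ContinuousOn f (Icc a b))
    (hpos : ∀ t ∈ Icc a b, 0 ≤ f t) : IsControlOn (fun u w ↦ ∫ t in u..w, f t) (Icc a b) where
  nonneg _ _ hu hw huw := intervalIntegral.integral_nonneg huw fun t ht ↦
    hpos t (Icc_subset_Icc hu.1 hw.2 ht)
  add_le _ _ _ hu hv hw _ _ := (intervalIntegral.integral_add_adjacent_intervals
    (hf.mono (uIcc_subset_Icc hu hv)).intervalIntegrable
    (hf.mono (uIcc_subset_Icc hv hw)).intervalIntegrable).le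

section ModelTrace

variable {E : Type*} [NormedAddCommGroup E] [NormedSpace ℝ E]
  {H : Type*} [TopologicalSpace H] {I : ModelWithCorners ℝ E H}
  {G : Type*} [TopologicalSpace G] [ChartedSpace H G] [Group G]
  {ρ C κ : ℝ} {N : Seminorm ℝ E}

section Tangent

variable {a b : ℝ} {γ : ℝ → G}

lemma ChartBounds.norm_derivWithin_sub_modelVelocity_le [LieGroup I 1 G]
    (hB : ChartBounds I G ρ C) (hab : a < b) {t : ℝ} (ht : t ∈ Icc a b)
    (hγ : MDifferentiableWithinAt 𝓘(ℝ, ℝ) I γ (Icc a b) t) (hγt : γ t ∈ chartBall I G ρ) :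
    ‖derivWithin (fun t ↦ chartLog I (γ t)) (Icc a b) t - modelVelocity I a b γ t‖ ≤
      2 * C * ‖chartLog I (γ t)‖ * ‖modelVelocity I a b γ t‖ := by
  have hvelocity : modelVelocity I a b γ t = chartMaurerCartan I G (chartLog I (γ t))
      (derivWithin (fun t ↦ chartLog I (γ t)) (Icc a b) t) :=
    leftVelocity_eq_chartMaurerCartan hab ht hγ hγt.1 (hB.differentiableAt hγt.2)
  rw [hvelocity]
  exact hB.norm_sub_maurerCartan_apply_le hγt.2 _

lemma ofReal_integral_modelVelocity [I.Boundaryless] [LieGroup I 1 G] (hN : Continuous N)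
    (hab : a < b) (hγ : ContMDiffOn 𝓘(ℝ, ℝ) I 1 γ (Icc a b)) :
    ENNReal.ofReal (∫ t in a..b, N (modelVelocity I a b γ t)) =
      ∫⁻ t in Icc a b, ENNReal.ofReal (N (modelVelocity I a b γ t)) := by
  have hint : IntegrableOn (fun t ↦ N (modelVelocity I a b γ t)) (Icc a b) :=
    (hN.comp_continuousOn (continuousOn_modelVelocity hab hγ)).integrableOn_Icc
  rw [intervalIntegral.integral_of_le hab.le, ← integral_Icc_eq_integral_Ioc,
    ofReal_integral_eq_lintegral_ofReal hint
      (ae_of_all _ fun t ↦ apply_nonneg N _)]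

variable [CompleteSpace E] [I.Boundaryless] [LieGroup I 1 G]

lemma ChartBounds.norm_chartLog_inv_mul_sub_modelTrace_le (hB : ChartBounds I G ρ C)
    (hab : a < b) (hγ : ContMDiffOn 𝓘(ℝ, ℝ) I 1 γ (Icc a b)) {M σ s t : ℝ}
    (hM : ∀ τ ∈ Icc a b, ‖modelVelocity I a b γ τ‖ ≤ M) (hσ : σ ≤ ρ) (has : a ≤ s)
    (hst : s ≤ t) (htb : t ≤ b) (hV : ∀ τ ∈ Icc s t, (γ s)⁻¹ * γ τ ∈ chartBall I G σ) :
    ‖chartLog I ((γ s)⁻¹ * γ t) - (modelTrace I a b γ t - modelTrace I a b γ s)‖ ≤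
      2 * C * σ * M * (t - s) := by
  rcases hst.eq_or_lt with rfl | hst'
  · simp
  have hC := hB.nonneg
  have hsub : Icc s t ⊆ Icc a b := Icc_subset_Icc has htb
  let q : ℝ → G := fun τ ↦ (γ s)⁻¹ * γ τ
  have hγd (τ) (hτ : τ ∈ Icc s t) : MDifferentiableWithinAt 𝓘(ℝ, ℝ) I γ (Icc a b) τ :=
    hγ.mdifferentiableOn one_ne_zero τ (hsub hτ)
  have hqd (τ) (hτ : τ ∈ Icc s t) : MDifferentiableWithinAt 𝓘(ℝ, ℝ) I q (Icc s t) τ :=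
    mdifferentiableAt_mul_left.comp_mdifferentiableWithinAt τ ((hγd τ hτ).mono hsub)
  have hvelocity (τ) (hτ : τ ∈ Icc s t) : modelVelocity I s t q τ = modelVelocity I a b γ τ :=
    (leftVelocity_const_mul hst' hτ _ ((hγd τ hτ).mono hsub)).trans
      (leftVelocity_subinterval has hst' htb hτ (hγd τ hτ))
  have hderiv (τ) (hτ : τ ∈ Icc s t) :=
    (differentiableWithinAt_chartLog_comp (hqd τ hτ) (hV τ hτ).1).hasDerivWithinAt.sub
      ((hasDerivWithinAt_modelTrace hab hγ (hsub hτ)).mono hsub)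
  have hbound (τ) (hτ : τ ∈ Icc s t) : ‖derivWithin (fun τ ↦ chartLog I (q τ)) (Icc s t) τ -
      modelVelocity I a b γ τ‖ ≤ 2 * C * σ * M := by
    rw [← hvelocity τ hτ]
    refine (hB.norm_derivWithin_sub_modelVelocity_le hst' hτ (hqd τ hτ)
      (chartBall_mono hσ (hV τ hτ))).trans ?_
    have hσ' : ‖chartLog I (q τ)‖ ≤ σ := (hV τ hτ).2.le
    have hMτ : ‖modelVelocity I s t q τ‖ ≤ M := hvelocity τ hτ ▸ hM τ (hsub hτ)
    have hσ0 := (norm_nonneg _).trans hσ'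
    gcongr
  have hmvt := (convex_Icc s t).norm_image_sub_le_of_norm_hasDerivWithin_le hderiv hbound
    (left_mem_Icc.2 hst) (right_mem_Icc.2 hst)
  rw [Real.norm_of_nonneg (sub_nonneg.2 hst)] at hmvt
  convert hmvt using 2
  simp only [Pi.sub_apply, inv_mul_cancel, chartLog_one, q]
  abel

theorem ChartBounds.isTangentOn_modelTrace (hB : ChartBounds I G ρ C) (hab : a < b)
    (hγ : ContMDiffOn 𝓘(ℝ, ℝ) I 1 γ (Icc a b)) :
    IsTangentOn (chartLog I) (chartBall I G ρ) γ (modelTrace I a b γ) a b := by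
  intro ε hε
  obtain ⟨M, hM0, hM⟩ := exists_norm_modelVelocity_le hab hγ
  have hC := hB.nonneg
  have hρ := hB.pos
  set σ := min ρ (ε / (2 * C * M + 1))
  have hσ : 0 < σ := by positivity
  have hσε : 2 * C * σ * M ≤ ε := by
    have := (le_div_iff₀ (by positivity)).1 (min_le_right ρ (ε / (2 * C * M + 1)))
    linarith
  have := topologicalGroup_of_lieGroup I (G := G) 1
  obtain ⟨h, hh, hstep⟩ := exists_inv_mul_mem_of_dist_le isCompact_Icc hγ.continuousOn
    ((isOpen_chartBall I (G := G) σ).mem_nhds (one_mem_chartBall I hσ))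
  refine ⟨h, hh, fun u w hau huw hwb hwu ↦ ?_⟩
  have hV (τ) (hτ : τ ∈ Icc u w) : (γ u)⁻¹ * γ τ ∈ chartBall I G σ :=
    hstep u ⟨hau, huw.trans hwb⟩ τ ⟨hau.trans hτ.1, hτ.2.trans hwb⟩ <| by
      rw [dist_comm, Real.dist_eq, abs_of_nonneg (sub_nonneg.2 hτ.1)]
      linarith [hτ.2]
  refine ⟨chartBall_mono (min_le_left _ _) (hV w ⟨huw, le_rfl⟩),
    (hB.norm_chartLog_inv_mul_sub_modelTrace_le hab hγ hM (min_le_left _ _) hau huw hwb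
      hV).trans ?_⟩
  gcongr

lemma seminorm_modelTrace_sub_le (hN : Continuous N) (hab : a < b)
    (hγ : ContMDiffOn 𝓘(ℝ, ℝ) I 1 γ (Icc a b)) {u w : ℝ} (hu : u ∈ Icc a b) (hw : w ∈ Icc a b)
    (huw : u ≤ w) : N (modelTrace I a b γ w - modelTrace I a b γ u) ≤
      ∫ t in u..w, N (modelVelocity I a b γ t) := by
  have hcont := (continuousOn_modelVelocity hab hγ).mono (Icc_subset_Icc hu.1 hw.2)
  rw [modelTrace_sub hab hγ hu hw, intervalIntegral.integral_of_le huw,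
    intervalIntegral.integral_of_le huw]
  exact seminorm_integral_le hN (hcont.integrableOn_Icc.mono_set Ioc_subset_Icc_self)
    ((hN.comp_continuousOn hcont).integrableOn_Icc.mono_set Ioc_subset_Icc_self)

end Tangent

/-- The length of a path controls the path as well as its trace, so sewing with exponent `1` keeps
a short path starting at the identity in the chart. -/
theorem ChartBounds.exists_chartLog_le_length [CompleteSpace E] [I.Boundaryless]
    [LieGroup I 1 G] (hB : ChartBounds I G ρ C) (hN : IsEquivalentNorm N κ) :
    ∃ δ > 0, ∃ K ≥ 0, ∀ ⦃c : ℝ → G⦄, ContMDiffOn 𝓘(ℝ, ℝ) I 1 c (Icc 0 1) → c 0 = 1 →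
      ∀ ⦃l : ℝ⦄, ∫ t in 0..1, N (modelVelocity I 0 1 c t) ≤ l → l < δ →
        N (chartLog I (c 1)) ≤ l + K * l ^ 2 := by
  obtain ⟨δ, hδ, K, hK, hsew⟩ := hB.toIsLocalLogarithm.exists_mem_and_norm_sub_le hB.pos
    hN.nonneg (p := 1) (by norm_num) le_rfl
  have hκ := hN.nonneg
  refine ⟨δ, hδ, κ * K, by positivity, fun c hc hc0 l hl hlδ ↦ ?_⟩
  have hNsub (u) (hu : u ∈ Icc (0 : ℝ) 1) (w) (hw : w ∈ Icc (0 : ℝ) 1) (huw : u ≤ w) :=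
    seminorm_modelTrace_sub_le hN.continuous one_pos hc hu hw huw
  have hcontrol := isControlOn_intervalIntegral
    (hN.continuous.comp_continuousOn (continuousOn_modelVelocity one_pos hc))
    fun t _ ↦ apply_nonneg N _
  obtain ⟨-, hle⟩ := hsew zero_le_one (hB.isTangentOn_modelTrace one_pos hc) hcontrol
    (fun u hu w hw huw _ ↦ by
      rw [Real.rpow_one]
      exact (min_le_right _ _).trans ((hN.norm_le_mul _).trans
        (mul_le_mul_of_nonneg_left (hNsub u hu w hw huw) hκ)))
    (by simpa using hl.trans_lt hlδ)
  simp only [hc0, inv_one, one_mul, Real.rpow_one, Function.comp_apply] at hle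
  have hlength := hNsub 0 (by simp) 1 (by simp) zero_le_one
  set Δ := modelTrace I 0 1 c 1 - modelTrace I 0 1 c 0
  set L := chartLog I (c 1)
  have hlength0 := (apply_nonneg N Δ).trans hlength
  calc N L ≤ N Δ + N (L - Δ) := le_map_add_map_sub N L Δ
    _ ≤ l + κ * (K * l ^ 2) := by
      gcongr
      · exact hlength.trans hl
      · refine (hN.le_mul_norm _).trans (mul_le_mul_of_nonneg_left (hle.trans ?_) hκ)
        gcongr
    _ = _ := by ring

theorem ChartBounds.exists_chartLog_le_leftInvariantEDist [CompleteSpace E] [I.Boundaryless]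
    [LieGroup I 1 G] (hB : ChartBounds I G ρ C) (hN : IsEquivalentNorm N κ) :
    ∃ δ > 0, ∃ K ≥ 0, ∀ ⦃g h : G⦄, leftInvariantEDist I N g h < ENNReal.ofReal δ →
      N (chartLog I (h⁻¹ * g)) ≤ (leftInvariantEDist I N g h).toReal +
        K * (leftInvariantEDist I N g h).toReal ^ 2 := by
  obtain ⟨δ, hδ, K, hK, hlength⟩ := hB.exists_chartLog_le_length hN
  refine ⟨δ, hδ, K, hK, fun g h hgh ↦ ?_⟩
  have hl_eq : leftInvariantEDist I N g h = leftInvariantEDist I N 1 (h⁻¹ * g) :=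
    leftInvariantEDist_eq_inv_mul' I N
  set l := (leftInvariantEDist I N g h).toReal
  have hlδ : l < δ := ENNReal.toReal_lt_of_lt_ofReal hgh
  have hlonger (l') (hl' : l' ∈ Ioo l δ) : N (chartLog I (h⁻¹ * g)) ≤ l' + K * l' ^ 2 := by
    have hl'_lt : leftInvariantEDist I N 1 (h⁻¹ * g) < ENNReal.ofReal l' :=
      hl_eq ▸ (ENNReal.lt_ofReal_iff_toReal_lt hgh.ne_top).2 hl'.1
    obtain ⟨c, hc0, hc1, hc, hlen⟩ := exists_lintegral_lt_of_leftInvariantEDist_lt I N hl'_lt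
    rw [← hc1]
    refine hlength hc hc0 ?_ hl'.2
    refine (ENNReal.ofReal_le_ofReal_iff (ENNReal.toReal_nonneg.trans hl'.1.le)).1 ?_
    exact (ofReal_integral_modelVelocity hN.continuous one_pos hc).trans_le hlen.le
  have hlim : Tendsto (fun l' ↦ l' + K * l' ^ 2) (𝓝[>] l) (𝓝 (l + K * l ^ 2)) :=
    ((by fun_prop : Continuous fun l' : ℝ ↦ l' + K * l' ^ 2).tendsto l).mono_left
      nhdsWithin_le_nhds
  exact ge_of_tendsto hlim (mem_of_superset (Ioo_mem_nhdsGT hlδ) fun l' hl' ↦ hlonger l' hl')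

section Segment

lemma norm_smul_lt_of_mem_Icc {x : E} {t : ℝ} (hx : ‖x‖ < ρ) (ht : t ∈ Icc (0 : ℝ) 1) :
    ‖t • x‖ < ρ := by
  rw [norm_smul, Real.norm_of_nonneg ht.1]
  exact (mul_le_of_le_one_left (norm_nonneg _) ht.2).trans_lt hx

variable [I.Boundaryless] [LieGroup I 1 G]

lemma ChartBounds.contMDiffOn_chartExp_smul (hB : ChartBounds I G ρ C) {x : E} (hx : ‖x‖ < ρ) :
    ContMDiffOn 𝓘(ℝ, ℝ) I 1 (fun t : ℝ ↦ chartExp I G (t • x)) (Icc 0 1) := fun t ht ↦ by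
  have hsmul : ContMDiffAt 𝓘(ℝ, ℝ) 𝓘(ℝ, E) 1 (fun t : ℝ ↦ t • x) t := by
    rw [contMDiffAt_iff_contDiffAt]
    fun_prop
  exact (ContMDiffAt.comp t
    (contMDiffAt_chartExp (hB.mem_target (norm_smul_lt_of_mem_Icc hx ht))) hsmul).contMDiffWithinAt

lemma ChartBounds.leftVelocity_chartExp_smul (hB : ChartBounds I G ρ C) {x : E} (hx : ‖x‖ < ρ)
    {t : ℝ} (ht : t ∈ Icc (0 : ℝ) 1) :
    leftVelocity I 0 1 (fun t ↦ chartExp I G (t • x)) t = chartMaurerCartan I G (t • x) x := by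
  have htarget (τ) (hτ : τ ∈ Icc (0 : ℝ) 1) := hB.mem_target (norm_smul_lt_of_mem_Icc hx hτ)
  have hlog (τ) (hτ : τ ∈ Icc (0 : ℝ) 1) : chartLog I (chartExp I G (τ • x)) = τ • x :=
    chartLog_chartExp (htarget τ hτ)
  have hderiv : derivWithin (fun t : ℝ ↦ chartLog I (chartExp I G (t • x))) (Icc 0 1) t = x := by
    rw [derivWithin_congr hlog (hlog t ht)]
    simpa using ((hasDerivAt_id t).smul_const x).hasDerivWithinAt.derivWithin
      (uniqueDiffOn_Icc one_pos t ht)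
  have hvelocity := leftVelocity_eq_chartMaurerCartan one_pos ht
    ((hB.contMDiffOn_chartExp_smul hx).mdifferentiableOn one_ne_zero t ht)
    ((extChartAt I (1 : G)).map_target (htarget t ht))
    (by rw [hlog t ht]; exact hB.differentiableAt (norm_smul_lt_of_mem_Icc hx ht))
  rwa [hderiv, hlog t ht] at hvelocity

theorem ChartBounds.leftInvariantEDist_one_le (hB : ChartBounds I G ρ C)
    (hN : IsEquivalentNorm N κ) {g : G} (hg : g ∈ chartBall I G ρ) :
    leftInvariantEDist I N 1 g ≤
      ENNReal.ofReal (N (chartLog I g) + C * κ * ‖chartLog I g‖ ^ 2) := by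
  set x := chartLog I g with hx
  have hxρ : ‖x‖ < ρ := hg.2
  have hC := hB.nonneg
  have hκ := hN.nonneg
  have hbound (t) (ht : t ∈ Icc (0 : ℝ) 1) :
      N (chartMaurerCartan I G (t • x) x) ≤ N x + C * κ * ‖x‖ ^ 2 := by
    set v := chartMaurerCartan I G (t • x) x
    have htx : ‖t • x‖ ≤ ‖x‖ := by
      rw [norm_smul, Real.norm_of_nonneg ht.1]
      exact mul_le_of_le_one_left (norm_nonneg _) ht.2
    have hv : ‖v - x‖ ≤ C * ‖x‖ * ‖x‖ :=
      (hB.norm_maurerCartan_apply_sub_le (htx.trans_lt hxρ) x).trans (by gcongr)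
    calc N v ≤ N x + N (v - x) := le_map_add_map_sub N v x
      _ ≤ N x + κ * (C * ‖x‖ * ‖x‖) := by
        gcongr
        exact (hN.le_mul_norm _).trans (by gcongr)
      _ = _ := by ring
  have hlength := leftInvariantEDist_le_lintegral I N zero_le_one
    (hB.contMDiffOn_chartExp_smul hxρ)
  simp only [zero_smul, chartExp_zero, one_smul] at hlength
  rw [hx, chartExp_chartLog hg.1, ← hx] at hlength
  calc leftInvariantEDist I N 1 g
      ≤ ∫⁻ t in Icc (0 : ℝ) 1,
          ENNReal.ofReal (N (leftVelocity I 0 1 (fun t ↦ chartExp I G (t • x)) t)) := hlength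
    _ ≤ ∫⁻ _ in Icc (0 : ℝ) 1, ENNReal.ofReal (N x + C * κ * ‖x‖ ^ 2) :=
        setLIntegral_mono' measurableSet_Icc fun t ht ↦ ENNReal.ofReal_le_ofReal <| by
          rw [hB.leftVelocity_chartExp_smul hxρ ht]
          exact hbound t ht
    _ = _ := by simp

end Segment

end ModelTrace

lemma ofReal_toReal_add_mul_sq_le (x v : ℝ≥0∞) {K : ℝ} (hK : 0 ≤ K) :
    ENNReal.ofReal (x.toReal + K * v.toReal ^ 2) ≤ x + ENNReal.ofReal K * v ^ 2 := by
  rw [ENNReal.ofReal_add (by positivity) (by positivity), ENNReal.ofReal_mul hK,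
    ENNReal.ofReal_pow (by positivity)]
  gcongr <;> exact ENNReal.ofReal_toReal_le

lemma IsEquivalentNorm.norm_le_of_le_add_mul_sq {E : Type*} [NormedAddCommGroup E]
    [NormedSpace ℝ E] {N : Seminorm ℝ E} {κ K l : ℝ} {x : E} (hN : IsEquivalentNorm N κ)
    (hK : 0 ≤ K) (hl : 0 ≤ l) (hl1 : l ≤ 1) (hx : N x ≤ l + K * l ^ 2) :
    ‖x‖ ≤ κ * (1 + K) * l := by
  have hκ := hN.nonneg
  calc ‖x‖ ≤ κ * (l + K * l ^ 2) := (hN.norm_le_mul x).trans (by gcongr)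
    _ ≤ κ * (l + K * (l * 1)) := by
        rw [sq]
        gcongr
    _ = _ := by ring

section ConstantPath

variable {E : Type*} [NormedAddCommGroup E] [NormedSpace ℝ E]
  {H : Type*} [TopologicalSpace H] (I : ModelWithCorners ℝ E H)
  {G : Type*} [TopologicalSpace G] [ChartedSpace H G] [Group G]
  (N : Seminorm ℝ (GroupLieAlgebra I G)) {r a : ℝ}

lemma groupVariation_self (hr : 0 < r) (γ : ℝ → G) : groupVariation I N r a a γ = 0 :=
  rVariation_self (fun _ ↦ leftInvariantEDist_self I N) hr

lemma traceVariation_self (hr : 0 < r) (γ : ℝ → G) : traceVariation I N r a a γ = 0 :=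
  rVariation_self (seminormEDist_self N) hr

end ConstantPath

section Estimates

variable {E : Type*} [NormedAddCommGroup E] [NormedSpace ℝ E]
  {H : Type*} [TopologicalSpace H] {I : ModelWithCorners ℝ E H} [I.Boundaryless]
  {G : Type*} [TopologicalSpace G] [ChartedSpace H G] [Group G] [LieGroup I 1 G]
  {ρ C κ r a b : ℝ} {N : Seminorm ℝ E} {γ : ℝ → G}

lemma exists_seminorm_modelVelocity_le (hN : Continuous N) (hab : a < b)
    (hγ : ContMDiffOn 𝓘(ℝ, ℝ) I 1 γ (Icc a b)) :
    ∃ M : NNReal, ∀ t ∈ Icc a b, N (modelVelocity I a b γ t) ≤ M := by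
  obtain ⟨M, hM⟩ := isCompact_Icc.exists_bound_of_continuousOn
    (hN.comp_continuousOn (continuousOn_modelVelocity hab hγ))
  exact ⟨M.toNNReal, fun t ht ↦ (le_abs_self _).trans ((hM t ht).trans (Real.le_coe_toNNReal M))⟩

lemma exists_isLipschitzOnIcc_leftInvariantEDist (hN : Continuous N) (hab : a < b)
    (hγ : ContMDiffOn 𝓘(ℝ, ℝ) I 1 γ (Icc a b)) :
    ∃ M, IsLipschitzOnIcc (leftInvariantEDist I N) M a b γ := by
  obtain ⟨M, hM⟩ := exists_seminorm_modelVelocity_le hN hab hγ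
  refine ⟨M, fun s t has hst htb ↦ ?_⟩
  rcases hst.eq_or_lt with rfl | hst'
  · simpa using (leftInvariantEDist_self I N).le
  have hsub := Icc_subset_Icc has htb
  calc leftInvariantEDist I N (γ t) (γ s)
      = leftInvariantEDist I N (γ s) (γ t) := leftInvariantEDist_comm I N
    _ ≤ ∫⁻ τ in Icc s t, ENNReal.ofReal (N (leftVelocity I s t γ τ)) :=
        leftInvariantEDist_le_lintegral I N hst (hγ.mono hsub)
    _ ≤ ∫⁻ _ in Icc s t, (M : ℝ≥0∞) :=
        setLIntegral_mono' measurableSet_Icc fun τ hτ ↦ by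
          rw [leftVelocity_subinterval has hst' htb hτ
            (hγ.mdifferentiableOn one_ne_zero τ (hsub hτ)), ENNReal.ofReal_le_coe]
          exact hM τ (hsub hτ)
    _ = M * ENNReal.ofReal (t - s) := by simp

lemma groupVariation_lt_top (hN : Continuous N) (hr1 : 1 ≤ r) (hab : a < b)
    (hγ : ContMDiffOn 𝓘(ℝ, ℝ) I 1 γ (Icc a b)) : groupVariation I N r a b γ < ⊤ := by
  obtain ⟨M, hM⟩ := exists_isLipschitzOnIcc_leftInvariantEDist hN hab hγ
  exact (hM.rVariation_ne_top (fun _ ↦ leftInvariantEDist_self I N) hr1 hab.le).lt_top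

variable [CompleteSpace E]

lemma exists_isLipschitzOnIcc_modelTrace (hN : Continuous N) (hab : a < b)
    (hγ : ContMDiffOn 𝓘(ℝ, ℝ) I 1 γ (Icc a b)) :
    ∃ M, IsLipschitzOnIcc (seminormEDist N) M a b (modelTrace I a b γ) := by
  obtain ⟨M, hM⟩ := exists_seminorm_modelVelocity_le hN hab hγ
  refine ⟨M, fun s t has hst htb ↦ ?_⟩
  have hsub := Icc_subset_Icc has htb
  have hcont : ContinuousOn (fun τ ↦ N (modelVelocity I a b γ τ)) (Icc s t) :=
    hN.comp_continuousOn ((continuousOn_modelVelocity hab hγ).mono hsub)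
  rw [← ENNReal.ofReal_coe_nnreal, ← ENNReal.ofReal_mul M.coe_nonneg]
  refine ENNReal.ofReal_le_ofReal ?_
  calc N (modelTrace I a b γ t - modelTrace I a b γ s)
      ≤ ∫ τ in s..t, N (modelVelocity I a b γ τ) :=
        seminorm_modelTrace_sub_le hN hab hγ ⟨has, hst.trans htb⟩ ⟨has.trans hst, htb⟩ hst
    _ ≤ ∫ _ in s..t, (M : ℝ) :=
        intervalIntegral.integral_mono_on hst (hcont.intervalIntegrable_of_Icc hst)
          intervalIntegrable_const fun τ hτ ↦ hM τ (hsub hτ)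
    _ = M * (t - s) := by rw [intervalIntegral.integral_const, smul_eq_mul, mul_comm]

lemma traceVariation_lt_top (hN : Continuous N) (hr1 : 1 ≤ r) (hab : a < b)
    (hγ : ContMDiffOn 𝓘(ℝ, ℝ) I 1 γ (Icc a b)) : traceVariation I N r a b γ < ⊤ := by
  obtain ⟨M, hM⟩ := exists_isLipschitzOnIcc_modelTrace hN hab hγ
  exact (hM.rVariation_ne_top (seminormEDist_self N) hr1 hab.le).lt_top

theorem ChartBounds.exists_norm_chartLog_sub_modelTrace_le (hB : ChartBounds I G ρ C)
    {X : Type*} {d : X → X → ℝ≥0∞} (hd : ∀ x, d x x = 0) (hr1 : 1 ≤ r) (hr2 : r < 2) {A η : ℝ}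
    (hA : 0 ≤ A) (hη : 0 < η) :
    ∃ δ > 0, δ < η ∧ ∃ K ≥ 0, ∀ ⦃a b γ c⦄, a < b → ContMDiffOn 𝓘(ℝ, ℝ) I 1 γ (Icc a b) →
      (∀ ⦃u⦄, u ∈ Icc a b → ∀ ⦃w⦄, w ∈ Icc a b → d (c w) (c u) < ENNReal.ofReal η →
        (γ u)⁻¹ * γ w ∈ chartBall I G ρ →
        min ‖chartLog I ((γ u)⁻¹ * γ w)‖ ‖modelTrace I a b γ w - modelTrace I a b γ u‖ ≤
          A * (d (c w) (c u)).toReal) →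
      ∀ ⦃s t⦄, a ≤ s → s ≤ t → t ≤ b → rVariation d r s t c ≤ ENNReal.ofReal δ →
        (γ s)⁻¹ * γ t ∈ chartBall I G ρ ∧
        ‖chartLog I ((γ s)⁻¹ * γ t) - (modelTrace I a b γ t - modelTrace I a b γ s)‖ ≤
          K * (rVariation d r s t c).toReal ^ 2 := by
  have hr0 : 0 < r := by linarith
  obtain ⟨δ₀, hδ₀, K, hK, hsew⟩ := hB.toIsLocalLogarithm.exists_mem_and_norm_sub_le hB.pos hA
    (p := 1 / r) (one_div_lt_one_div_of_lt hr0 hr2) ((div_le_one hr0).2 hr1)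
  obtain ⟨δ, hδ, hδ_lt⟩ := exists_between (lt_min hδ₀ hη)
  have hδη : δ < η := hδ_lt.trans_le (min_le_right _ _)
  refine ⟨δ, hδ, hδη, K, hK, fun a b γ c hab hγ hmin s t has hst htb hle ↦ ?_⟩
  obtain ⟨Ω, hΩ, hΩst, hdΩ⟩ := exists_isControlOn_of_rVariation_ne_top hd hr0 hst
    (ne_top_of_le_ne_top ENNReal.ofReal_ne_top hle)
  have hsub := Icc_subset_Icc has htb
  have hcontrol (u) (hu : u ∈ Icc s t) (w) (hw : w ∈ Icc s t) (huw : u ≤ w)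
      (hmem : (γ u)⁻¹ * γ w ∈ chartBall I G ρ) : min ‖chartLog I ((γ u)⁻¹ * γ w)‖
        ‖modelTrace I a b γ w - modelTrace I a b γ u‖ ≤ A * Ω u w ^ (1 / r) := by
    have hsmall : d (c w) (c u) < ENNReal.ofReal η :=
      calc d (c w) (c u) ≤ rVariation d r u w c := edist_le_rVariation hd hr0 huw
        _ ≤ rVariation d r s t c := rVariation_mono hd hr0 hu.1 huw hw.2
        _ ≤ ENNReal.ofReal δ := hle
        _ < ENNReal.ofReal η := (ENNReal.ofReal_lt_ofReal_iff hη).2 hδη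
    refine (hmin (hsub hu) (hsub hw) hsmall hmem).trans (mul_le_mul_of_nonneg_left ?_ hA)
    exact ENNReal.toReal_le_of_le_ofReal (Real.rpow_nonneg (hΩ.nonneg hu hw huw) _)
      (hdΩ u hu w hw huw)
  rw [← hΩst]
  exact hsew hst ((hB.isTangentOn_modelTrace hab hγ).mono has htb) hΩ hcontrol <| by
    rw [hΩst]
    exact (ENNReal.toReal_le_of_le_ofReal hδ.le hle).trans_lt (hδ_lt.trans_le (min_le_left _ _))

theorem ChartBounds.exists_isLocallyDominated_leftInvariantEDist (hB : ChartBounds I G ρ C)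
    (hN : IsEquivalentNorm N κ) (hr1 : 1 ≤ r) (hr2 : r < 2) :
    ∃ δ K : ℝ, 0 < δ ∧ δ ≤ 1 ∧ ∀ ⦃a b⦄ ⦃γ : ℝ → G⦄, a < b →
      ContMDiffOn 𝓘(ℝ, ℝ) I 1 γ (Icc a b) →
      IsLocallyDominated (leftInvariantEDist I N) (seminormEDist N) r a b γ
        (modelTrace I a b γ) (ENNReal.ofReal δ) (ENNReal.ofReal K) := by
  have hr0 : 0 < r := by linarith
  have hκ := hN.nonneg
  have hC := hB.nonneg
  obtain ⟨δ, hδ, hδ1, K, hK, hclose⟩ := hB.exists_norm_chartLog_sub_modelTrace_le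
    (seminormEDist_self N) hr1 hr2 hκ one_pos
  refine ⟨δ, κ * K + C * κ * (κ + K) ^ 2, hδ, hδ1.le, fun a b γ hab hγ s t has hst htb hle ↦ ?_⟩
  set v := rVariation (seminormEDist N) r s t (modelTrace I a b γ)
  obtain ⟨hmem, hL⟩ := hclose hab hγ (fun u _ w _ _ _ ↦ (min_le_right _ _).trans <| by
    simpa only [seminormEDist, ENNReal.toReal_ofReal (apply_nonneg N _)] using
      hN.norm_le_mul (modelTrace I a b γ w - modelTrace I a b γ u)) has hst htb hle
  set Δ := modelTrace I a b γ t - modelTrace I a b γ s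
  set L := chartLog I ((γ s)⁻¹ * γ t)
  have hv1 : v.toReal ≤ 1 := (ENNReal.toReal_le_of_le_ofReal hδ.le hle).trans hδ1.le
  have hΔ : N Δ ≤ v.toReal := (ENNReal.ofReal_le_iff_le_toReal
    (ne_top_of_le_ne_top ENNReal.ofReal_ne_top hle)).1
      (edist_le_rVariation (seminormEDist_self N) hr0 hst)
  have hNL : N L ≤ N Δ + κ * (K * v.toReal ^ 2) :=
    calc N L ≤ N Δ + N (L - Δ) := le_map_add_map_sub N L Δ
      _ ≤ N Δ + κ * (K * v.toReal ^ 2) := by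
        gcongr
        exact (hN.le_mul_norm _).trans (by gcongr)
  have hnormL : ‖L‖ ≤ (κ + K) * v.toReal :=
    calc ‖L‖ ≤ ‖Δ‖ + ‖L - Δ‖ := norm_le_insert' L Δ
      _ ≤ κ * v.toReal + K * (v.toReal * 1) := by
        refine add_le_add ((hN.norm_le_mul Δ).trans (by gcongr)) (hL.trans ?_)
        rw [sq]
        gcongr
      _ = _ := by ring
  calc leftInvariantEDist I N (γ t) (γ s)
      = leftInvariantEDist I N 1 ((γ s)⁻¹ * γ t) := leftInvariantEDist_eq_inv_mul' I N
    _ ≤ ENNReal.ofReal (N L + C * κ * ‖L‖ ^ 2) := hB.leftInvariantEDist_one_le hN hmem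
    _ ≤ ENNReal.ofReal (N Δ + κ * (K * v.toReal ^ 2) + C * κ * ((κ + K) * v.toReal) ^ 2) := by
        gcongr
    _ = ENNReal.ofReal ((ENNReal.ofReal (N Δ)).toReal +
          (κ * K + C * κ * (κ + K) ^ 2) * v.toReal ^ 2) := by
        rw [ENNReal.toReal_ofReal (apply_nonneg N Δ)]
        ring_nf
    _ ≤ _ := ofReal_toReal_add_mul_sq_le _ v (by positivity)

theorem ChartBounds.exists_isLocallyDominated_seminormEDist (hB : ChartBounds I G ρ C)
    (hN : IsEquivalentNorm N κ) (hr1 : 1 ≤ r) (hr2 : r < 2) :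
    ∃ δ K : ℝ, 0 < δ ∧ δ ≤ 1 ∧ ∀ ⦃a b⦄ ⦃γ : ℝ → G⦄, a < b →
      ContMDiffOn 𝓘(ℝ, ℝ) I 1 γ (Icc a b) →
      IsLocallyDominated (seminormEDist N) (leftInvariantEDist I N) r a b
        (modelTrace I a b γ) γ (ENNReal.ofReal δ) (ENNReal.ofReal K) := by
  have hr0 : 0 < r := by linarith
  have hκ := hN.nonneg
  obtain ⟨η₀, hη₀, K₀, hK₀, hlog⟩ := hB.exists_chartLog_le_leftInvariantEDist hN
  set η := min η₀ 1
  have hη : 0 < η := by positivity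
  have hηη₀ : ENNReal.ofReal η ≤ ENNReal.ofReal η₀ := ENNReal.ofReal_le_ofReal (min_le_left _ _)
  obtain ⟨δ, hδ, hδη, K, hK, hclose⟩ := hB.exists_norm_chartLog_sub_modelTrace_le
    (X := G) (d := leftInvariantEDist I N) (fun _ ↦ leftInvariantEDist_self I N) hr1 hr2
    (A := κ * (1 + K₀)) (by positivity) hη
  refine ⟨δ, K₀ + κ * K, hδ, hδη.le.trans (min_le_right _ _),
    fun a b γ hab hγ s t has hst htb hle ↦ ?_⟩
  set v := rVariation (leftInvariantEDist I N) r s t γ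
  obtain ⟨-, hL⟩ := hclose hab hγ (fun u _ w _ hsmall _ ↦ (min_le_left _ _).trans <|
    hN.norm_le_of_le_add_mul_sq hK₀ ENNReal.toReal_nonneg
      ((ENNReal.toReal_lt_of_lt_ofReal hsmall).le.trans (min_le_right _ _))
      (hlog (hsmall.trans_le hηη₀))) has hst htb hle
  set Δ := modelTrace I a b γ t - modelTrace I a b γ s
  set L := chartLog I ((γ s)⁻¹ * γ t)
  set l := leftInvariantEDist I N (γ t) (γ s)
  have hlv : l ≤ v := edist_le_rVariation (fun _ ↦ leftInvariantEDist_self I N) hr0 hst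
  have hlη : l < ENNReal.ofReal η :=
    (hlv.trans hle).trans_lt ((ENNReal.ofReal_lt_ofReal_iff hη).2 hδη)
  have hlv' : l.toReal ≤ v.toReal :=
    ENNReal.toReal_mono (ne_top_of_le_ne_top ENNReal.ofReal_ne_top hle) hlv
  refine le_trans (ENNReal.ofReal_le_ofReal ?_)
    (ofReal_toReal_add_mul_sq_le l v (K := K₀ + κ * K) (by positivity))
  calc N Δ ≤ N L + N (Δ - L) := le_map_add_map_sub N Δ L
    _ ≤ (l.toReal + K₀ * l.toReal ^ 2) + κ * ‖L - Δ‖ :=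
        add_le_add (hlog (hlη.trans_le hηη₀)) (norm_sub_rev L Δ ▸ hN.le_mul_norm _)
    _ ≤ (l.toReal + K₀ * v.toReal ^ 2) + κ * (K * v.toReal ^ 2) := by gcongr
    _ = _ := by ring

end Estimates

section VariationBounds

variable {E : Type*} [NormedAddCommGroup E] [NormedSpace ℝ E] [CompleteSpace E]
  {H : Type*} [TopologicalSpace H] {I : ModelWithCorners ℝ E H} [I.Boundaryless]
  {G : Type*} [TopologicalSpace G] [ChartedSpace H G] [Group G] [LieGroup I 2 G]
  {κ r : ℝ} {N : Seminorm ℝ E}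

theorem exists_groupVariation_le (hN : IsEquivalentNorm N κ) (hr1 : 1 ≤ r) (hr2 : r < 2) :
    ∃ D : NNReal, ∀ ⦃a b⦄ ⦃γ : ℝ → G⦄, a < b →
      ContMDiffOn 𝓘(ℝ, ℝ) I 1 γ (Icc a b) → groupVariation I N r a b γ ≤
        traceVariation I N r a b γ + D * min (traceVariation I N r a b γ ^ 2)
          (traceVariation I N r a b γ ^ r) := by
  obtain ⟨ρ, C, hB⟩ := exists_chartBounds I G
  obtain ⟨δ, K, hδ, hδ1, hdom⟩ := hB.exists_isLocallyDominated_leftInvariantEDist hN hr1 hr2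
  obtain ⟨D, hD⟩ := exists_rVariation_le_of_isLocallyDominated
    (fun _ : G ↦ leftInvariantEDist_self I N) (leftInvariantEDist_triangle I N)
    (seminormEDist_self N) hr1 hr2.le hδ hδ1
  refine ⟨D, fun a b γ hab hγ ↦ ?_⟩
  obtain ⟨M, hM⟩ := exists_isLipschitzOnIcc_modelTrace hN.continuous hab hγ
  exact hD (hdom hab hγ) hM hab.le

theorem exists_traceVariation_le (hN : IsEquivalentNorm N κ) (hr1 : 1 ≤ r) (hr2 : r < 2) :
    ∃ D : NNReal, ∀ ⦃a b⦄ ⦃γ : ℝ → G⦄, a < b →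
      ContMDiffOn 𝓘(ℝ, ℝ) I 1 γ (Icc a b) → traceVariation I N r a b γ ≤
        groupVariation I N r a b γ + D * min (groupVariation I N r a b γ ^ 2)
          (groupVariation I N r a b γ ^ r) := by
  obtain ⟨ρ, C, hB⟩ := exists_chartBounds I G
  obtain ⟨δ, K, hδ, hδ1, hdom⟩ := hB.exists_isLocallyDominated_seminormEDist hN hr1 hr2
  obtain ⟨D, hD⟩ := exists_rVariation_le_of_isLocallyDominated (seminormEDist_self N)
    (seminormEDist_triangle N) (fun _ : G ↦ leftInvariantEDist_self I N) hr1 hr2.le hδ hδ1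
  refine ⟨D, fun a b γ hab hγ ↦ ?_⟩
  obtain ⟨M, hM⟩ := exists_isLipschitzOnIcc_leftInvariantEDist hN.continuous hab hγ
  exact hD (hdom hab hγ) hM hab.le

end VariationBounds

end LieVariation

end

theorem mainTheorem6_general
    {E : Type*} [NormedAddCommGroup E] [NormedSpace ℝ E] [CompleteSpace E]
    {H : Type*} [TopologicalSpace H] (I : ModelWithCorners ℝ E H) [I.Boundaryless]
    {G : Type*} [TopologicalSpace G] [ChartedSpace H G] [Group G] [LieGroup I 2 G]
    (N : Seminorm ℝ (GroupLieAlgebra I G)) {κ : ℝ}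
    (hN : LieVariation.IsEquivalentNorm (E := E) N κ) (r : ℝ) (hr1 : 1 ≤ r) (hr2 : r < 2) :
    ∃ C : ℝ, 0 < C ∧
      ∀ (a b : ℝ) (_ : a ≤ b) (γ : ℝ → G) (_ : ContMDiffOn 𝓘(ℝ, ℝ) I 1 γ (Set.Icc a b)),
        LieVariation.groupVariation I N r a b γ < ⊤ ∧
        LieVariation.traceVariation I N r a b γ < ⊤ ∧
        LieVariation.groupVariation I N r a b γ ≤
          LieVariation.traceVariation I N r a b γ +
            ENNReal.ofReal C * min (LieVariation.traceVariation I N r a b γ ^ 2)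
              (LieVariation.traceVariation I N r a b γ ^ r) ∧
        LieVariation.traceVariation I N r a b γ ≤
          LieVariation.groupVariation I N r a b γ +
            ENNReal.ofReal C * min (LieVariation.groupVariation I N r a b γ ^ 2)
              (LieVariation.groupVariation I N r a b γ ^ r) := by
  obtain ⟨D₁, hD₁⟩ := LieVariation.exists_groupVariation_le (G := G) hN hr1 hr2
  obtain ⟨D₂, hD₂⟩ := LieVariation.exists_traceVariation_le (G := G) hN hr1 hr2
  refine ⟨(D₁ + D₂ + 1 : NNReal), by positivity, fun a b hab γ hγ ↦ ?_⟩
  rw [ENNReal.ofReal_coe_nnreal]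
  rcases hab.eq_or_lt with rfl | hab
  · have hr0 : 0 < r := by linarith
    simp [LieVariation.groupVariation_self I N hr0, LieVariation.traceVariation_self I N hr0]
  refine ⟨LieVariation.groupVariation_lt_top hN.continuous hr1 hab hγ,
    LieVariation.traceVariation_lt_top hN.continuous hr1 hab hγ,
    (hD₁ hab hγ).trans ?_, (hD₂ hab hγ).trans ?_⟩
  · gcongr
    rw [add_assoc]
    exact le_self_add
  · gcongr
    exact le_add_self.trans le_self_add

theorem mainTheorem6
    {E : Type*} [NormedAddCommGroup E] [NormedSpace ℝ E] [FiniteDimensional ℝ E]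
    {H : Type*} [TopologicalSpace H] (I : ModelWithCorners ℝ E H) [I.Boundaryless]
    {G : Type*} [TopologicalSpace G] [ChartedSpace H G] [Group G] [LieGroup I ∞ G]
    [ConnectedSpace G]
    (N : Seminorm ℝ (GroupLieAlgebra I G)) (hN : ∀ v, N v = 0 → v = 0)
    (r : ℝ) (hr1 : 1 ≤ r) (hr2 : r < 2) :
    ∃ C : ℝ, 0 < C ∧
      ∀ (a b : ℝ) (_ : a ≤ b) (γ : ℝ → G) (_ : ContMDiffOn 𝓘(ℝ, ℝ) I ∞ γ (Set.Icc a b)),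
        LieVariation.groupVariation I N r a b γ < ⊤ ∧
        LieVariation.traceVariation I N r a b γ < ⊤ ∧
        LieVariation.groupVariation I N r a b γ ≤
          LieVariation.traceVariation I N r a b γ +
            ENNReal.ofReal C * min (LieVariation.traceVariation I N r a b γ ^ 2)
              (LieVariation.traceVariation I N r a b γ ^ r) ∧
        LieVariation.traceVariation I N r a b γ ≤
          LieVariation.groupVariation I N r a b γ +
            ENNReal.ofReal C * min (LieVariation.groupVariation I N r a b γ ^ 2)
              (LieVariation.groupVariation I N r a b γ ^ r) := by
  have : CompleteSpace E := FiniteDimensional.complete ℝ E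
  obtain ⟨κ, hκ⟩ := LieVariation.exists_isEquivalentNorm (E := E) N hN
  obtain ⟨C, hC, h⟩ := mainTheorem6_general I N hκ r hr1 hr2
  exact ⟨C, hC, fun a b hab γ hγ ↦ h a b hab γ (hγ.of_le (by simp))⟩
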